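/- Let $K$ be an imaginary quadratic field of discriminant $-D_K$, embedded in $\mathbf{C}$, with ring of integers $\mathcal{O}$ and inverse different $\mathcal{D}^{-1}=\frac{1}{\sqrt{-D_K}}\mathcal{O}$. Let $N\ge 1$ be an integer, let $k\ge 1$ be an integer with $\#\mathcal{O}^\times \mid k$, and let $p$ be a prime with $p\mid N$. Put $$\Gamma=\Gamma_0^{(2)}(N)=\left\{\begin{bmatrix}A&B\\C&D\end{bmatrix}\in \mathrm{GL}_4(\mathcal{O}) \;:\; {}^t\overline{M}JM=J \text{ for } M=\begin{bmatrix}A&B\\C&D\end{bmatrix},\ C\in N M_2(\mathcal{O})\right\},\qquad J=\begin{bmatrix}0&-I_2\\I_2&0\end{bmatrix},$$ $$\mathbf{H}_2=\{Z\in M_2(\mathbf{C}) : (Z-{}^t\overline{Z})/(2i)>0\},\qquad \mathcal{S}=\left\{\begin{bmatrix}\ell&t\\ \overline{t}&m\end{bmatrix} : \ell,m\in\mathbf{Z},\ t\in\mathcal{D}^{-1}\right\},$$ and for $0\ne T\in\mathcal{S}$ let $\epsilon(T)=\max\{q\in\mathbf{Z}_{>0} : \frac1q T\in\mathcal{S}\}$.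 Let $\mathcal{M}_k(N)$ be the space of holomorphic functions $F$ on $\mathbf{H}_2$ with $F((AZ+B)(CZ+D)^{-1})=\det(CZ+D)^kF(Z)$ for all $\begin{bmatrix}A&B\\C&D\end{bmatrix}\in\Gamma$; such an $F$ has a Fourier expansion $F(Z)=\sum_{T\in\mathcal{S},\,T\ge 0}C_F(T)e^{2\pi i\,\mathrm{tr}(TZ)}$. The Maass space $\mathcal{M}^*_k(N)$ is the space of all $F\in\mathcal{M}_k(N)$ for which there is a function $\alpha_F^*:\mathbf{Z}_{\ge 0}\to\mathbf{C}$ such that $$C_F(T)=\sum_{\substack{d\ge 1,\ d\mid\epsilon(T)\\ \gcd(d,N)=1}}d^{k-1}\,\alpha_F^*\!\left(\frac{D_K\det T}{d^2}\right)\qquad\text{for all } T\in\mathcal{S},\ T\ge 0,\ T\ne 0. \tag{$*$}$$ The Hecke operator $U_p$ attached to the double coset $\Gamma\,\mathrm{diag}(1,1,p,p)\,\Gamma$ is $U_pF=\sum_{g} F|_kg$, where $g=\begin{bmatrix}A&B\\C&D\end{bmatrix}$ runs over representatives of the (finitely many) cosets $\Gamma g\subset\Gamma\,\mathrm{diag}(1,1,p,p)\,\Gamma$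 and $(F|_kg)(Z)=\det(CZ+D)^{-k}F((AZ+B)(CZ+D)^{-1})$. **Proposition.** If $F\in\mathcal{M}^*_k(N)$, then $U_pF\in\mathcal{M}^*_k(N)$. More precisely, if $\alpha_F^*$ is any function satisfying $(*)$ for $F$, then $$\alpha_{U_pF}^*(x)=p^{-2k+4}\,\alpha_F^*(p^2x)\qquad(x\in\mathbf{Z}_{\ge 0})$$ is a function satisfying $(*)$ for $U_pF$. -/

import Mathlib

open scoped ComplexOrder Matrix.Norms.Elementwise

noncomputable section

namespace HermitianMaass

/-- Complex `2 × 2` matrices. -/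
abbrev Mat2 : Type := Matrix (Fin 2) (Fin 2) ℂ

/-- Complex `4 × 4` matrices, viewed as `2 × 2` blocks of size `2 × 2`. -/
abbrev Mat4 : Type := Matrix (Fin 2 ⊕ Fin 2) (Fin 2 ⊕ Fin 2) ℂ

/-- The group `GL₄(ℂ)`, with `4 × 4` matrices viewed in blocks. -/
abbrev GL4 : Type := Matrix.GeneralLinearGroup (Fin 2 ⊕ Fin 2) ℂ

/-- `e[z] = exp (2 π i z)`. -/
def e (z : ℂ) : ℂ := Complex.exp (2 * Real.pi * Complex.I * z)

/-- The Hermitian upper half space: all `Z` with `(Z - Zᴴ) / (2 i)` positive definite. -/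
def upperHalfSpace : Set Mat2 :=
  {Z | ((2 * Complex.I)⁻¹ • (Z - Z.conjTranspose)).PosDef}

section Lattice

variable {K : Type*} [Field K] [NumberField K]

/-- The ring of integers of `K`, as a subring of `ℂ` through the embedding `σ`. -/
def integers (σ : K →+* ℂ) : Subring ℂ :=
  (σ.comp (algebraMap (NumberField.RingOfIntegers K) K)).range

variable (K) in
/-- `D_K`, the absolute value of the discriminant of `K`. -/
def absDisc : ℕ := (NumberField.discr K).natAbs

/-- The inverse different `𝒟⁻¹ = 𝒪 / √(-D_K)` of an imaginary quadratic field, inside `ℂ`. -/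
def inverseDifferent (σ : K →+* ℂ) : Set ℂ :=
  {t | ∃ b ∈ integers σ, t = b / (Complex.I * (Real.sqrt (absDisc K) : ℂ))}

/-- The lattice `𝒮` dual to the integral Hermitian matrices: matrices
`[[ℓ, t], [conj t, m]]` with `ℓ, m ∈ ℤ` and `t ∈ 𝒟⁻¹`. -/
def dualLattice (σ : K →+* ℂ) : Set Mat2 :=
  {T | ∃ l m : ℤ, ∃ t ∈ inverseDifferent σ, T = !![(l : ℂ), t; star t, (m : ℂ)]}

/-- `ε(T) = max {q ∈ ℤ₊ | (1/q) T ∈ 𝒮}` (meaningful for `T ∈ 𝒮`, `T ≠ 0`). -/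
def content (σ : K →+* ℂ) (T : Mat2) : ℕ :=
  sSup {q : ℕ | 0 < q ∧ (q : ℂ)⁻¹ • T ∈ dualLattice σ}

variable (K) in
/-- The number `D_K · det T / d²`. It is a natural number whenever `T / d ∈ 𝒮` is positive
semidefinite, see `cast_detIndex`; the rounding has no effect then. -/
def detIndex (T : Mat2) (d : ℕ) : ℕ :=
  ⌊((absDisc K : ℂ) * T.det / (d : ℂ) ^ 2).re⌋₊

variable [Algebra.IsQuadraticExtension ℚ K] [NumberField.IsTotallyComplex K]

/-- The integers of an imaginary quadratic field are stable under complex conjugation. -/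
theorem star_mem_integers (σ : K →+* ℂ) {a : ℂ} (ha : a ∈ integers σ) :
    star a ∈ integers σ := by
  have : NumberField.IsCMField K := NumberField.IsCMField.ofCMExtension ℚ K
  obtain ⟨x, rfl⟩ := ha
  refine ⟨NumberField.IsCMField.ringOfIntegersComplexConj K x, ?_⟩
  have h := NumberField.IsCMField.complexEmbedding_complexConj (K := K) σ (x : K)
  simp only [RingHom.comp_apply]
  exact h

/-- Norms of integers of an imaginary quadratic field are natural numbers. -/
theorem exists_norm_eq (σ : K →+* ℂ) {a : ℂ} (ha : a ∈ integers σ) :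
    ∃ n : ℕ, (n : ℂ) = a * star a := by
  obtain ⟨x, rfl⟩ := ha
  set w : NumberField.InfinitePlace K := NumberField.InfinitePlace.mk σ with hw
  have hcard : Fintype.card (NumberField.InfinitePlace K) = 1 := by
    have h1 := NumberField.InfinitePlace.card_eq_nrRealPlaces_add_nrComplexPlaces K
    have h2 := NumberField.IsTotallyComplex.finrank (K := K)
    have h3 := NumberField.IsTotallyComplex.nrRealPlaces_eq_zero K
    have h4 := Algebra.IsQuadraticExtension.finrank_eq_two ℚ K
    omega
  have : Unique (NumberField.InfinitePlace K) :=
    ⟨⟨w⟩, fun v => (Fintype.card_le_one_iff.mp hcard.le) v w⟩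
  have h := NumberField.InfinitePlace.prod_eq_abs_norm (x : K)
  rw [Fintype.prod_unique, NumberField.IsTotallyComplex.mult_eq,
    Subsingleton.elim (default : NumberField.InfinitePlace K) w, hw,
    NumberField.InfinitePlace.apply, ← Algebra.coe_norm_int] at h
  refine ⟨(Algebra.norm ℤ x).natAbs, ?_⟩
  have h2 : (((Algebra.norm ℤ x).natAbs : ℕ) : ℝ) = ‖σ (x : K)‖ ^ 2 := by
    rw [h, Nat.cast_natAbs]
    push_cast
    rfl
  change _ = σ (x : K) * (starRingEnd ℂ) (σ (x : K))
  rw [Complex.mul_conj, Complex.normSq_eq_norm_sq, ← h2]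
  push_cast
  rfl

/-- For `T / d ∈ 𝒮` positive semidefinite, `D_K · det T / d²` is a natural number. -/
theorem cast_detIndex (σ : K →+* ℂ) {T : Mat2} {d : ℕ}
    (hT : (d : ℂ)⁻¹ • T ∈ dualLattice σ) (hpos : T.PosSemidef) :
    (detIndex K T d : ℂ) = (absDisc K : ℂ) * T.det / (d : ℂ) ^ 2 := by
  rcases eq_or_ne d 0 with rfl | hd
  · simp [detIndex]
  have hd' : (d : ℂ) ≠ 0 := Nat.cast_ne_zero.mpr hd
  obtain ⟨l, m, t, ⟨b, hb, rfl⟩, hT⟩ := hT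
  obtain ⟨n, hn⟩ := exists_norm_eq σ hb
  have hD : (absDisc K : ℂ) ≠ 0 :=
    Nat.cast_ne_zero.mpr (Int.natAbs_ne_zero.mpr (NumberField.discr_ne_zero K))
  have hs : (Real.sqrt (absDisc K) : ℂ) ^ 2 = absDisc K := by
    rw [← Complex.ofReal_pow, Real.sq_sqrt (Nat.cast_nonneg _)]
    simp
  have hs0 : (Real.sqrt (absDisc K) : ℂ) ≠ 0 := fun h0 => hD (by rw [← hs, h0]; simp)
  have hdet : T.det / (d : ℂ) ^ 2 = ((d : ℂ)⁻¹ • T).det := by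
    rw [Matrix.det_smul, Fintype.card_fin, inv_pow, div_eq_inv_mul]
  have key : (absDisc K : ℂ) * T.det / (d : ℂ) ^ 2 =
      (((absDisc K : ℤ) * l * m - n : ℤ) : ℂ) := by
    rw [mul_div_assoc, hdet, hT, Matrix.det_fin_two_of]
    push_cast
    rw [hn]
    have hstar : star (b / (Complex.I * (Real.sqrt (absDisc K) : ℂ))) =
        - (star b / (Complex.I * (Real.sqrt (absDisc K) : ℂ))) := by
      simp only [Complex.star_def, map_div₀, map_mul, Complex.conj_I, Complex.conj_ofReal]
      rw [neg_mul, div_neg]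
    rw [hstar]
    have hI : Complex.I ≠ 0 := Complex.I_ne_zero
    simp only [← hs]
    field_simp
    rw [Complex.I_sq]
    ring
  have hnn : 0 ≤ (absDisc K : ℤ) * l * m - n := by
    have h1 : (0 : ℂ) ≤ (absDisc K : ℂ) * T.det / (d : ℂ) ^ 2 := by
      have h2 := hpos.det_nonneg
      have h3 : (0 : ℂ) ≤ ((d : ℂ) ^ 2)⁻¹ := by
        have : ((d : ℂ) ^ 2)⁻¹ = (((d : ℝ) ^ 2)⁻¹ : ℝ) := by push_cast; rfl
        rw [this]
        exact Complex.zero_le_real.mpr (by positivity)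
      rw [div_eq_mul_inv]
      exact mul_nonneg (mul_nonneg (Nat.cast_nonneg _) h2) h3
    rw [key] at h1
    have h4 := (Complex.le_def.mp h1).1
    simp only [Complex.zero_re, Complex.intCast_re] at h4
    exact_mod_cast h4
  unfold detIndex
  rw [key]
  obtain ⟨j, hj⟩ := Int.eq_ofNat_of_zero_le hnn
  rw [hj]
  simp

end Lattice

section Group

variable {K : Type*} [Field K] [NumberField K]
  [Algebra.IsQuadraticExtension ℚ K] [NumberField.IsTotallyComplex K]

/-- `Γ₀⁽²⁾(N)`: matrices `g` with entries in `𝒪` satisfying `gᴴ J g = J`, where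
`J = [[0, -1], [1, 0]]`, whose lower left block has entries in `N 𝒪`. -/
def Gamma0 (σ : K →+* ℂ) (N : ℕ) : Subgroup GL4 where
  carrier := {g | (∀ i j, g.1 i j ∈ integers σ) ∧
    g.1.conjTranspose * Matrix.J (Fin 2) ℂ * g.1 = Matrix.J (Fin 2) ℂ ∧
    ∀ i j, ∃ c ∈ integers σ, g.1 (Sum.inr i) (Sum.inl j) = (N : ℂ) * c}
  one_mem' := by
    refine ⟨fun i j => ?_, by simp, fun i j => ⟨0, zero_mem _, ?_⟩⟩
    · rcases eq_or_ne i j with rfl | h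
      · simp
      · simp [Matrix.one_apply_ne h]
    · simp
  mul_mem' := by
    rintro g h ⟨hg, hgJ, hgN⟩ ⟨hh, hhJ, hhN⟩
    refine ⟨fun i j => ?_, ?_, fun i j => ?_⟩
    · simp only [Units.val_mul, Matrix.mul_apply]
      exact sum_mem fun l _ => mul_mem (hg i l) (hh l j)
    · calc _ = h.1.conjTranspose * (g.1.conjTranspose * Matrix.J (Fin 2) ℂ * g.1) * h.1 := by
            simp only [Units.val_mul, Matrix.conjTranspose_mul, Matrix.mul_assoc]
        _ = _ := by rw [hgJ, hhJ]
    · choose c hc hgc using hgN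
      choose c' hc' hhc using hhN
      refine ⟨∑ l, (c i l * h.1 (Sum.inl l) (Sum.inl j) + g.1 (Sum.inr i) (Sum.inr l) * c' l j),
        sum_mem fun l _ => add_mem (mul_mem (hc i l) (hh _ _)) (mul_mem (hg _ _) (hc' l j)), ?_⟩
      simp only [Units.val_mul, Matrix.mul_apply, Fintype.sum_sum_type, hgc, hhc,
        Finset.mul_sum, ← Finset.sum_add_distrib]
      exact Finset.sum_congr rfl fun l _ => by ring
  inv_mem' := by
    rintro g ⟨hg, hgJ, hgN⟩
    have hinv : (g⁻¹).1 = -(Matrix.J (Fin 2) ℂ * g.1.conjTranspose * Matrix.J (Fin 2) ℂ) := by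
      have h1 : -(Matrix.J (Fin 2) ℂ * g.1.conjTranspose * Matrix.J (Fin 2) ℂ) * g.1 = 1 := by
        calc _ = -(Matrix.J (Fin 2) ℂ *
              (g.1.conjTranspose * Matrix.J (Fin 2) ℂ * g.1)) := by
              simp only [Matrix.neg_mul, Matrix.mul_assoc]
          _ = 1 := by rw [hgJ, Matrix.J_squared, neg_neg]
      exact Units.inv_eq_of_mul_eq_one_left h1
    have hblk : (g⁻¹).1 = Matrix.fromBlocks g.1.toBlocks₂₂.conjTranspose
        (-g.1.toBlocks₁₂.conjTranspose) (-g.1.toBlocks₂₁.conjTranspose)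
        g.1.toBlocks₁₁.conjTranspose := by
      rw [hinv]
      conv_lhs => rw [← Matrix.fromBlocks_toBlocks g.1]
      simp only [Matrix.J, Matrix.fromBlocks_conjTranspose, Matrix.fromBlocks_multiply,
        Matrix.fromBlocks_neg]
      simp
    refine ⟨fun i j => ?_, ?_, fun i j => ?_⟩
    · rw [hblk]
      rcases i with i | i <;> rcases j with j | j
      · exact star_mem_integers σ (hg _ _)
      · exact neg_mem (star_mem_integers σ (hg _ _))
      · exact neg_mem (star_mem_integers σ (hg _ _))
      · exact star_mem_integers σ (hg _ _)
    · have h1 : g.1 * (g⁻¹).1 = 1 := by simp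
      calc _ = (g⁻¹).1.conjTranspose *
            (g.1.conjTranspose * Matrix.J (Fin 2) ℂ * g.1) * (g⁻¹).1 := by rw [hgJ]
        _ = (g.1 * (g⁻¹).1).conjTranspose * Matrix.J (Fin 2) ℂ * (g.1 * (g⁻¹).1) := by
            simp only [Matrix.conjTranspose_mul, Matrix.mul_assoc]
        _ = _ := by rw [h1]; simp
    · obtain ⟨c, hc, h⟩ := hgN j i
      refine ⟨-star c, neg_mem (star_mem_integers σ hc), ?_⟩
      rw [hblk]
      simp [Matrix.toBlocks₂₁, h]

end Group

/-- The weight `k` action `(F|ₖ g)(Z) = det(CZ+D)⁻ᵏ F((AZ+B)(CZ+D)⁻¹)` for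
`g = [[A, B], [C, D]]`. -/
def slash (k : ℕ) (g : GL4) (F : Mat2 → ℂ) (Z : Mat2) : ℂ :=
  (((g.1.toBlocks₂₁ * Z + g.1.toBlocks₂₂).det) ^ k)⁻¹ *
    F ((g.1.toBlocks₁₁ * Z + g.1.toBlocks₁₂) * (g.1.toBlocks₂₁ * Z + g.1.toBlocks₂₂)⁻¹)

/-- The matrix `diag(1, 1, p, p)`. -/
def diagP (p : ℕ) [Fact p.Prime] : GL4 :=
  Matrix.GeneralLinearGroup.mkOfDetNeZero
    (Matrix.fromBlocks 1 0 0 ((p : ℂ) • (1 : Mat2))) (by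
      have hp : (p : ℂ) ≠ 0 := Nat.cast_ne_zero.mpr (Fact.out : p.Prime).ne_zero
      simp [Matrix.det_fromBlocks_zero₂₁, hp])

section Forms

variable {K : Type*} [Field K] [NumberField K]
  [Algebra.IsQuadraticExtension ℚ K] [NumberField.IsTotallyComplex K]

/-- The space `ℳ_k(N)` of Hermitian modular forms of weight `k` and level `N`. Functions on the
Hermitian upper half space are represented by functions on all matrices; values outside the half
space play no role. -/
def modularForms (σ : K →+* ℂ) (N k : ℕ) : Submodule ℂ (Mat2 → ℂ) where
  carrier := {F | DifferentiableOn ℂ F upperHalfSpace ∧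
    ∀ g ∈ Gamma0 σ N, ∀ Z ∈ upperHalfSpace,
      F ((g.1.toBlocks₁₁ * Z + g.1.toBlocks₁₂) * (g.1.toBlocks₂₁ * Z + g.1.toBlocks₂₂)⁻¹) =
        (g.1.toBlocks₂₁ * Z + g.1.toBlocks₂₂).det ^ k * F Z}
  zero_mem' := ⟨differentiableOn_const 0, by simp⟩
  add_mem' := by
    rintro F G ⟨hF, hF'⟩ ⟨hG, hG'⟩
    refine ⟨hF.add hG, fun g hg Z hZ => ?_⟩
    simp only [Pi.add_apply, hF' g hg Z hZ, hG' g hg Z hZ, mul_add]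
  smul_mem' := by
    rintro c F ⟨hF, hF'⟩
    refine ⟨hF.const_smul c, fun g hg Z hZ => ?_⟩
    simp only [Pi.smul_apply, smul_eq_mul, hF' g hg Z hZ]
    ring

/-- `F(Z) = ∑ C(T) e[tr TZ]` on the Hermitian upper half space, where `T` runs over the positive
semidefinite matrices in `𝒮` (absolutely convergent sum). -/
def HasFourierExpansion (σ : K →+* ℂ) (F : Mat2 → ℂ) (C : Mat2 → ℂ) : Prop :=
  ∀ Z ∈ upperHalfSpace,
    HasSum (fun T : {T : Mat2 // T ∈ dualLattice σ ∧ T.PosSemidef} =>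
      C T.1 * e (T.1 * Z).trace) (F Z)

/-- `α` is a function `α*_F : ℤ_{≥0} → ℂ` describing the Fourier coefficients `C_F(T)`, `T ≠ 0`,
of `F` by the Maass relations of weight `k` and level `N`. -/
def IsMaassFunction (σ : K →+* ℂ) (N k : ℕ) (F : Mat2 → ℂ) (α : ℕ → ℂ) : Prop :=
  ∃ C : Mat2 → ℂ, HasFourierExpansion σ F C ∧
    ∀ T ∈ dualLattice σ, T.PosSemidef → T ≠ 0 →
      C T = ∑ d ∈ (content σ T).divisors with d.Coprime N,
        (d : ℂ) ^ (k - 1) * α (detIndex K T d)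

/-- The Maass space `ℳ*_k(N)`. -/
def maassSpace (σ : K →+* ℂ) (N k : ℕ) : Submodule ℂ (Mat2 → ℂ) where
  carrier := {F | F ∈ modularForms σ N k ∧ ∃ α : ℕ → ℂ, IsMaassFunction σ N k F α}
  zero_mem' := ⟨zero_mem _, 0, 0, fun Z _ => by simp [hasSum_zero], by simp⟩
  add_mem' := by
    rintro F G ⟨hF, α, C, hC, h⟩ ⟨hG, β, D, hD, h'⟩
    refine ⟨add_mem hF hG, α + β, C + D, fun Z hZ => ?_, fun T h1 h2 h3 => ?_⟩
    · simpa [add_mul] using (hC Z hZ).add (hD Z hZ)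
    · simp [h T h1 h2 h3, h' T h1 h2 h3, mul_add, Finset.sum_add_distrib]
  smul_mem' := by
    rintro c F ⟨hF, α, C, hC, h⟩
    refine ⟨Submodule.smul_mem _ c hF, c • α, c • C, fun Z hZ => ?_, fun T h1 h2 h3 => ?_⟩
    · simpa [mul_assoc] using (hC Z hZ).mul_left c
    · simp [h T h1 h2 h3, Finset.mul_sum, mul_left_comm]

/-- The cosets `Γ g` contained in the double coset `Γ diag(1,1,p,p) Γ`, for `Γ = Γ₀⁽²⁾(N)`. -/
def heckeCosets (σ : K →+* ℂ) (N p : ℕ) [Fact p.Prime] :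
    Set (Quotient (QuotientGroup.rightRel (Gamma0 σ N))) :=
  Quotient.mk _ '' DoubleCoset.doubleCoset (diagP p) (Gamma0 σ N : Set GL4) (Gamma0 σ N)

/-- The Hecke operator `U_p`, given by the double coset `Γ diag(1,1,p,p) Γ`:
the sum of `F|ₖ g` over representatives `g` of the (finitely many) cosets `Γ g` in it. On the
Hermitian upper half space the sum does not depend on the representatives if `F` is modular. -/
def heckeU (σ : K →+* ℂ) (N k p : ℕ) [Fact p.Prime] (F : Mat2 → ℂ) : Mat2 → ℂ :=
  fun Z => ∑ᶠ q ∈ heckeCosets σ N p, slash k q.out F Z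

end Forms

end HermitianMaass

end

namespace HermitianMaass

open Matrix

/-! ### The action of Hermitian similitudes on the upper half space -/

/-! Because `p ∣ N`, the lower left block of every element of `Γ` vanishes modulo `p`. This forces
the double coset of `diag(1,1,p,p)` to be the disjoint union of the `p⁴` cosets `Γ [[1, B], [0,
p]]`, with `B` running over the integral Hermitian matrices modulo `p`
(`exists_mk_eq_of_mem_doubleCoset`, `mk_diagP_mul_unipotent_eq_iff`). Hence `U_p F(Z) = p^(-2k) ∑_B
F((Z + B)/p)` on the half space.

In the Fourier expansion the coefficient at `T` is multiplied by the sum over `B` of `e(tr(TB)/p)`.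
Since `𝒮` is dual to the integral Hermitian matrices under the trace, this sum is `p⁴` for `T ∈ p𝒮`
and `0` otherwise (`sum_e_eq_zero`), so `C_{U_p F}(T) = p^(4-2k) C_F(pT)`.

In the Maass relation at `pT` only `d` prime to `N`, hence to `p`, occur. Such a `d` divides `ε(pT)`
exactly when it divides `ε(T)` (`inv_smul_smul_mem_dualLattice_iff`), and `D_K det(pT)/d² = p² D_K
det(T)/d²`; this is the claimed formula. Modularity of `U_p F` holds because right translation by
`Γ` permutes the cosets, and holomorphy because the sum is finite. -/

/-- The numerator `AZ + B` of the action of `g = [[A, B], [C, D]]`. -/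
def num (g : GL4) (Z : Mat2) : Mat2 := g.1.toBlocks₁₁ * Z + g.1.toBlocks₁₂

/-- The denominator `CZ + D` of the action of `g = [[A, B], [C, D]]`. -/
def den (g : GL4) (Z : Mat2) : Mat2 := g.1.toBlocks₂₁ * Z + g.1.toBlocks₂₂

/-- The fractional linear transformation `Z ↦ (AZ + B)(CZ + D)⁻¹`. -/
noncomputable def moebius (g : GL4) (Z : Mat2) : Mat2 := num g Z * (den g Z)⁻¹

theorem slash_eq (k : ℕ) (g : GL4) (F : Mat2 → ℂ) (Z : Mat2) :
    slash k g F Z = ((den g Z).det ^ k)⁻¹ * F (moebius g Z) := rfl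

/-- `g` is a similitude of the skew-Hermitian form `J` with positive multiplier `c`. -/
def IsSimilitude (g : GL4) (c : ℝ) : Prop :=
  0 < c ∧ g.1.conjTranspose * Matrix.J (Fin 2) ℂ * g.1 = (c : ℂ) • Matrix.J (Fin 2) ℂ

theorem IsSimilitude.mul {g h : GL4} {c d : ℝ} (hg : IsSimilitude g c) (hh : IsSimilitude h d) :
    IsSimilitude (g * h) (c * d) := by
  refine ⟨mul_pos hg.1 hh.1, ?_⟩
  calc _ = h.1.conjTranspose * (g.1.conjTranspose * Matrix.J (Fin 2) ℂ * g.1) * h.1 := by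
        simp only [Units.val_mul, Matrix.conjTranspose_mul, Matrix.mul_assoc]
    _ = _ := by
        rw [hg.2, Matrix.mul_smul, Matrix.smul_mul, hh.2, smul_smul, Complex.ofReal_mul]

theorem IsSimilitude.blocks {g : GL4} {c : ℝ} (hg : IsSimilitude g c) :
    g.1.toBlocks₂₁ᴴ * g.1.toBlocks₁₁ = g.1.toBlocks₁₁ᴴ * g.1.toBlocks₂₁ ∧
    g.1.toBlocks₁₁ᴴ * g.1.toBlocks₂₂ = (c : ℂ) • 1 + g.1.toBlocks₂₁ᴴ * g.1.toBlocks₁₂ ∧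
    g.1.toBlocks₂₂ᴴ * g.1.toBlocks₁₁ = (c : ℂ) • 1 + g.1.toBlocks₁₂ᴴ * g.1.toBlocks₂₁ ∧
    g.1.toBlocks₂₂ᴴ * g.1.toBlocks₁₂ = g.1.toBlocks₁₂ᴴ * g.1.toBlocks₂₂ := by
  have h := hg.2
  rw [← Matrix.fromBlocks_toBlocks g.1] at h
  simp only [Matrix.J, Matrix.fromBlocks_conjTranspose, Matrix.fromBlocks_multiply,
    Matrix.fromBlocks_smul] at h
  obtain ⟨h1, h2, h3, h4⟩ := Matrix.fromBlocks_inj.mp h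
  simp only [Matrix.mul_zero, Matrix.mul_one, Matrix.mul_neg, Matrix.neg_mul, zero_add, add_zero,
    smul_zero, smul_neg, ← sub_eq_add_neg] at h1 h2 h3 h4
  refine ⟨sub_eq_zero.mp h1, ?_, sub_eq_iff_eq_add.mp h3, sub_eq_zero.mp h4⟩
  rw [← neg_eq_iff_eq_neg, neg_sub] at h2
  exact sub_eq_iff_eq_add.mp h2

/-- The source of `Im(gZ) = c (CZ+D)⁻ᴴ Im(Z) (CZ+D)⁻¹`, stated without inverses so that it can also
show that `CZ + D` is invertible. -/
theorem IsSimilitude.den_conjTranspose_mul_num {g : GL4} {c : ℝ} (hg : IsSimilitude g c)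
    (Z : Mat2) :
    (den g Z)ᴴ * num g Z - (num g Z)ᴴ * den g Z = (c : ℂ) • (Z - Zᴴ) := by
  obtain ⟨h1, h2, h3, h4⟩ := hg.blocks
  simp only [den, num, conjTranspose_add, conjTranspose_mul]
  generalize g.1.toBlocks₁₁ = A at *
  generalize g.1.toBlocks₁₂ = B at *
  generalize g.1.toBlocks₂₁ = C at *
  generalize g.1.toBlocks₂₂ = D at *
  calc _ = Zᴴ * (Cᴴ * A) * Z - Zᴴ * (Aᴴ * C) * Z + Zᴴ * (Cᴴ * B) - Zᴴ * (Aᴴ * D)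
        + (Dᴴ * A) * Z - (Bᴴ * C) * Z + Dᴴ * B - Bᴴ * D := by noncomm_ring
    _ = _ := by
      rw [h1, h2, h3, h4]
      simp only [Matrix.mul_add, Matrix.add_mul, Matrix.mul_smul, Matrix.smul_mul, Matrix.mul_one,
        Matrix.one_mul, smul_sub]
      abel

/-- If `(CZ+D)v = 0` with `v ≠ 0`, the preceding identity evaluated at `v` gives `vᴴ(Z - Zᴴ)v = 0`,
against positive definiteness. -/
theorem IsSimilitude.det_den_ne_zero {g : GL4} {c : ℝ} (hg : IsSimilitude g c) {Z : Mat2}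
    (hZ : Z ∈ upperHalfSpace) : (den g Z).det ≠ 0 := by
  intro h0
  obtain ⟨v, hv, h⟩ := Matrix.exists_mulVec_eq_zero_iff.mpr h0
  have h1 := (show PosDef _ from hZ).dotProduct_mulVec_pos hv
  have h2 : (c : ℂ) • (Z - Zᴴ) *ᵥ v = (den g Z)ᴴ *ᵥ (num g Z *ᵥ v) := by
    rw [← Matrix.smul_mulVec, ← hg.den_conjTranspose_mul_num, Matrix.sub_mulVec,
      ← Matrix.mulVec_mulVec, ← Matrix.mulVec_mulVec, h, Matrix.mulVec_zero, sub_zero]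
  have h3 : star v ⬝ᵥ ((c : ℂ) • (Z - Zᴴ) *ᵥ v) = 0 := by
    rw [h2, Matrix.dotProduct_mulVec, ← Matrix.star_mulVec, h]
    simp
  have hc : (c : ℂ) ≠ 0 := Complex.ofReal_ne_zero.mpr hg.1.ne'
  rw [dotProduct_smul, smul_eq_mul, mul_eq_zero, or_iff_right hc] at h3
  rw [Matrix.smul_mulVec, dotProduct_smul, h3, smul_zero] at h1
  exact lt_irrefl _ h1

theorem IsSimilitude.moebius_mem {g : GL4} {c : ℝ} (hg : IsSimilitude g c) {Z : Mat2}
    (hZ : Z ∈ upperHalfSpace) : moebius g Z ∈ upperHalfSpace := by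
  have hu : IsUnit (den g Z).det := (hg.det_den_ne_zero hZ).isUnit
  have hu' : IsUnit (den g Z)ᴴ.det := by
    rw [Matrix.det_conjTranspose]; exact hu.star
  have key : moebius g Z - (moebius g Z)ᴴ =
      (c : ℂ) • (((den g Z)⁻¹)ᴴ * (Z - Zᴴ) * (den g Z)⁻¹) := by
    rw [← Matrix.smul_mul, ← Matrix.mul_smul, ← hg.den_conjTranspose_mul_num, moebius,
      conjTranspose_mul, Matrix.mul_sub, Matrix.sub_mul, conjTranspose_nonsing_inv,
      ← Matrix.mul_assoc, Matrix.nonsing_inv_mul _ hu', Matrix.one_mul, Matrix.mul_assoc _ _ (den g Z)⁻¹,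
      Matrix.mul_assoc _ _ (den g Z)⁻¹, Matrix.mul_nonsing_inv _ hu, Matrix.mul_one]
  have h1 : (((den g Z)⁻¹)ᴴ * ((2 * Complex.I)⁻¹ • (Z - Zᴴ)) * (den g Z)⁻¹).PosDef := by
    refine PosDef.conjTranspose_mul_mul_same hZ ?_
    apply Matrix.mulVec_injective_of_isUnit
    rw [Matrix.isUnit_nonsing_inv_iff, Matrix.isUnit_iff_isUnit_det]
    exact hu
  have h2 := h1.smul (show (0 : ℂ) < (c : ℂ) from by exact_mod_cast hg.1)
  rw [upperHalfSpace, Set.mem_ofPred_eq, key, smul_comm]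
  rw [Matrix.mul_smul, Matrix.smul_mul] at h2
  exact h2

theorem toBlocks_mul (g h : GL4) (Z : Mat2) :
    num (g * h) Z = g.1.toBlocks₁₁ * num h Z + g.1.toBlocks₁₂ * den h Z ∧
    den (g * h) Z = g.1.toBlocks₂₁ * num h Z + g.1.toBlocks₂₂ * den h Z := by
  have h1 : (g * h).1 = fromBlocks g.1.toBlocks₁₁ g.1.toBlocks₁₂ g.1.toBlocks₂₁ g.1.toBlocks₂₂ *
      fromBlocks h.1.toBlocks₁₁ h.1.toBlocks₁₂ h.1.toBlocks₂₁ h.1.toBlocks₂₂ := by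
    rw [Matrix.fromBlocks_toBlocks, Matrix.fromBlocks_toBlocks]
    rfl
  rw [Matrix.fromBlocks_multiply] at h1
  simp only [num, den, h1, toBlocks_fromBlocks₁₁, toBlocks_fromBlocks₁₂, toBlocks_fromBlocks₂₁,
    toBlocks_fromBlocks₂₂]
  constructor <;> noncomm_ring

/-- This is the cocycle relation `den (gh) Z = den g (hZ) * den h Z`. Only `den h Z` gets cancelled,
so `g` may be arbitrary. -/
theorem IsSimilitude.slash_mul {h : GL4} {c : ℝ} (hh : IsSimilitude h c) (k : ℕ) (g : GL4)
    (F : Mat2 → ℂ) {Z : Mat2} (hZ : Z ∈ upperHalfSpace) :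
    slash k (g * h) F Z = slash k h (slash k g F) Z := by
  have hu : IsUnit (den h Z).det := (hh.det_den_ne_zero hZ).isUnit
  have hn : num h Z = moebius h Z * den h Z := by
    rw [moebius, Matrix.mul_assoc, Matrix.nonsing_inv_mul _ hu, Matrix.mul_one]
  obtain ⟨h1, h2⟩ := toBlocks_mul g h Z
  have h1' : num (g * h) Z = num g (moebius h Z) * den h Z := by
    rw [h1, num.eq_1 g, Matrix.add_mul, Matrix.mul_assoc, ← hn]
  have h2' : den (g * h) Z = den g (moebius h Z) * den h Z := by
    rw [h2, den.eq_1 g, Matrix.add_mul, Matrix.mul_assoc, ← hn]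
  have h3 : moebius (g * h) Z = moebius g (moebius h Z) := by
    rw [moebius, h1', h2', Matrix.mul_inv_rev, Matrix.mul_assoc, ← Matrix.mul_assoc (den h Z),
      Matrix.mul_nonsing_inv _ hu, Matrix.one_mul, ← moebius.eq_1 g]
  rw [slash_eq, slash_eq, slash_eq, h3, h2', Matrix.det_mul, mul_pow, mul_inv]
  ring

/-! ### Modularity of the Hecke operator -/

/-- Right translation of right cosets. -/
def cosetMulRight {G : Type*} [Group G] (H : Subgroup G) (g : G) :
    Quotient (QuotientGroup.rightRel H) → Quotient (QuotientGroup.rightRel H) :=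
  Quotient.map (· * g) fun a b hab => by
    change QuotientGroup.rightRel H _ _
    rw [QuotientGroup.rightRel_apply]
    have h : QuotientGroup.rightRel H a b := hab
    rw [QuotientGroup.rightRel_apply] at h
    simpa [mul_assoc] using h

variable {K : Type*} [Field K] [NumberField K]
  [Algebra.IsQuadraticExtension ℚ K] [NumberField.IsTotallyComplex K]

theorem isSimilitude_of_mem_Gamma0 {σ : K →+* ℂ} {N : ℕ} {g : GL4} (hg : g ∈ Gamma0 σ N) :
    IsSimilitude g 1 :=
  ⟨one_pos, by rw [hg.2.1]; simp⟩

theorem slash_of_mem_modularForms {σ : K →+* ℂ} {N k : ℕ} {F : Mat2 → ℂ}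
    (hF : F ∈ modularForms σ N k) {g : GL4} (hg : g ∈ Gamma0 σ N) {Z : Mat2}
    (hZ : Z ∈ upperHalfSpace) : slash k g F Z = F Z := by
  have h := hF.2 g hg Z hZ
  have h0 := (isSimilitude_of_mem_Gamma0 hg).det_den_ne_zero hZ
  change F (moebius g Z) = (den g Z).det ^ k * F Z at h
  rw [slash_eq, h, inv_mul_cancel_left₀ (pow_ne_zero k h0)]

/-- Makes the arbitrary representatives `q.out` in `heckeU` harmless: `h = γg` with `γ ∈ Γ`, and `γ`
acts trivially on `F` at the point `gZ` of the half space. -/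
theorem slash_congr_coset {σ : K →+* ℂ} {N k : ℕ} {F : Mat2 → ℂ}
    (hF : F ∈ modularForms σ N k) {g h : GL4} {c : ℝ} (hg : IsSimilitude g c)
    (hgh : (Quotient.mk (QuotientGroup.rightRel (Gamma0 σ N)) h) = Quotient.mk _ g) {Z : Mat2}
    (hZ : Z ∈ upperHalfSpace) : slash k h F Z = slash k g F Z := by
  have h1 : QuotientGroup.rightRel (Gamma0 σ N) g h := Quotient.exact hgh.symm
  rw [QuotientGroup.rightRel_apply] at h1
  have h2 : h = (h * g⁻¹) * g := by group
  rw [h2, hg.slash_mul k _ F hZ, slash_eq, slash_of_mem_modularForms hF h1 (hg.moebius_mem hZ),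
    ← slash_eq]

theorem isSimilitude_diagP (p : ℕ) [Fact p.Prime] : IsSimilitude (diagP p) p := by
  refine ⟨Nat.cast_pos.mpr (Fact.out : p.Prime).pos, ?_⟩
  change (fromBlocks 1 0 0 ((p : ℂ) • (1 : Mat2)))ᴴ * _ * fromBlocks 1 0 0 ((p : ℂ) • (1 : Mat2)) = _
  simp [Matrix.J, fromBlocks_conjTranspose, fromBlocks_multiply, fromBlocks_smul]

theorem isSimilitude_of_mem_doubleCoset {σ : K →+* ℂ} {N p : ℕ} [Fact p.Prime] {g : GL4}
    (hg : g ∈ DoubleCoset.doubleCoset (diagP p) (Gamma0 σ N : Set GL4) (Gamma0 σ N)) :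
    IsSimilitude g p := by
  obtain ⟨x, hx, y, hy, rfl⟩ := DoubleCoset.mem_doubleCoset.mp hg
  simpa using ((isSimilitude_of_mem_Gamma0 hx).mul (isSimilitude_diagP p)).mul
    (isSimilitude_of_mem_Gamma0 hy)

theorem cosetMulRight_mem_heckeCosets {σ : K →+* ℂ} {N p : ℕ} [Fact p.Prime] {g : GL4}
    (hg : g ∈ Gamma0 σ N) {q : Quotient (QuotientGroup.rightRel (Gamma0 σ N))}
    (hq : q ∈ heckeCosets σ N p) : cosetMulRight _ g q ∈ heckeCosets σ N p := by
  obtain ⟨h, hh, rfl⟩ := hq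
  obtain ⟨x, hx, y, hy, rfl⟩ := DoubleCoset.mem_doubleCoset.mp hh
  exact ⟨x * diagP p * y * g,
    DoubleCoset.mem_doubleCoset.mpr ⟨x, hx, y * g, mul_mem hy hg, by simp only [mul_assoc]⟩, rfl⟩

theorem cosetMulRight_cancel {G : Type*} [Group G] (H : Subgroup G) {g h : G} (hgh : g * h = 1)
    (q : Quotient (QuotientGroup.rightRel H)) :
    cosetMulRight H h (cosetMulRight H g q) = q := by
  induction q using Quotient.inductionOn with
  | h a =>
    change Quotient.mk _ (a * g * h) = Quotient.mk _ a
    rw [mul_assoc, hgh, mul_one]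

theorem bijOn_cosetMulRight {σ : K →+* ℂ} {N p : ℕ} [Fact p.Prime] {g : GL4}
    (hg : g ∈ Gamma0 σ N) :
    Set.BijOn (cosetMulRight (Gamma0 σ N) g) (heckeCosets σ N p) (heckeCosets σ N p) :=
  Set.InvOn.bijOn (f' := cosetMulRight (Gamma0 σ N) g⁻¹)
    ⟨fun q _ => cosetMulRight_cancel _ (mul_inv_cancel g) q,
      fun q _ => cosetMulRight_cancel _ (inv_mul_cancel g) q⟩
    (fun _ hq => cosetMulRight_mem_heckeCosets hg hq)
    (fun _ hq => cosetMulRight_mem_heckeCosets (inv_mem hg) hq)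

/-- Acting by `g` sends the term of a coset `q` to that of `qg`, so it merely reindexes the sum
along `bijOn_cosetMulRight`. -/
theorem slash_heckeU {σ : K →+* ℂ} {N k p : ℕ} [Fact p.Prime] {F : Mat2 → ℂ}
    (hF : F ∈ modularForms σ N k) {g : GL4} (hg : g ∈ Gamma0 σ N) {Z : Mat2}
    (hZ : Z ∈ upperHalfSpace) :
    slash k g (heckeU σ N k p F) Z = heckeU σ N k p F Z := by
  rw [slash_eq]
  unfold heckeU
  rw [mul_finsum_mem]
  refine finsum_mem_eq_of_bijOn _ (bijOn_cosetMulRight hg) ?_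
  rintro _ ⟨h, hh, rfl⟩
  rw [← slash_eq k g (slash k _ F) Z, ← (isSimilitude_of_mem_Gamma0 hg).slash_mul k _ F hZ]
  have hs := (isSimilitude_of_mem_doubleCoset hh).mul (isSimilitude_of_mem_Gamma0 hg)
  have hout : ∀ q : Quotient (QuotientGroup.rightRel (Gamma0 σ N)), Quotient.mk _ q.out = q :=
    Quotient.out_eq
  rw [slash_congr_coset hF hs (h := Quotient.out (cosetMulRight (Gamma0 σ N) g _)) (hout _) hZ]
  refine slash_congr_coset hF hs ?_ hZ
  exact congrArg (cosetMulRight (Gamma0 σ N) g) (hout (Quotient.mk _ h))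

end HermitianMaass

namespace HermitianMaass

/-! ### The lattices `𝒪` and `𝒮` in coordinates -/

section Coordinates

variable {K : Type*} [Field K] [NumberField K]

/-- `(b₁, b₂)` is a `ℤ`-basis of `𝒪` with `b₁ conj(b₂) - b₂ conj(b₁) = √(-D_K)`. -/
structure IsOrientedBasis (σ : K →+* ℂ) (b₁ b₂ : ℂ) : Prop where
  mem_iff : ∀ a : ℂ, a ∈ integers σ ↔ ∃ x y : ℤ, a = x * b₁ + y * b₂
  area : b₁ * star b₂ - b₂ * star b₁ = Complex.I * (Real.sqrt (absDisc K) : ℂ)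

theorem sqrt_absDisc_ne_zero : (Real.sqrt (absDisc K) : ℂ) ≠ 0 := by
  have : (0 : ℝ) < absDisc K :=
    Nat.cast_pos.mpr (Int.natAbs_pos.mpr (NumberField.discr_ne_zero K))
  exact_mod_cast (Real.sqrt_pos.mpr this).ne'

theorem area_ne_zero : Complex.I * (Real.sqrt (absDisc K) : ℂ) ≠ 0 :=
  mul_ne_zero Complex.I_ne_zero sqrt_absDisc_ne_zero

variable [Algebra.IsQuadraticExtension ℚ K] [NumberField.IsTotallyComplex K]

/-- A totally complex quadratic field has exactly two complex embeddings, `σ` and its conjugate, and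
the trace is the sum over them. -/
theorem cast_trace_eq (σ : K →+* ℂ) (w : NumberField.RingOfIntegers K) :
    ((Algebra.trace ℤ (NumberField.RingOfIntegers K) w : ℤ) : ℂ) =
      σ (w : K) + star (σ (w : K)) := by
  classical
  have hreal : NumberField.ComplexEmbedding.conjugate σ ≠ σ :=
    (NumberField.InfinitePlace.isComplex_mk_iff.mp
      (NumberField.IsTotallyComplex.isComplex (NumberField.InfinitePlace.mk σ)))
  have hcard : Fintype.card (K →+* ℂ) = 2 := by
    rw [NumberField.Embeddings.card, Algebra.IsQuadraticExtension.finrank_eq_two ℚ K]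
  have huniv : (Finset.univ : Finset (K →+* ℂ)) =
      {σ, NumberField.ComplexEmbedding.conjugate σ} := by
    symm
    apply Finset.eq_univ_of_card
    rw [hcard, Finset.card_pair hreal.symm]
  have h1 := trace_eq_sum_embeddings (K := ℚ) (L := K) ℂ (x := (w : K))
  rw [← Algebra.coe_trace_int] at h1
  have h2 : ∑ τ : K →ₐ[ℚ] ℂ, τ (w : K) = ∑ τ : K →+* ℂ, τ (w : K) :=
    Fintype.sum_equiv (RingHom.equivRatAlgHom K ℂ).symm _ _ fun τ => rfl
  rw [h2, huniv, Finset.sum_pair hreal.symm] at h1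
  simpa using h1

/-- A real integer of an imaginary quadratic field is a rational integer. -/
theorem exists_int_eq_of_star_eq (σ : K →+* ℂ) {a : ℂ} (ha : a ∈ integers σ) (hs : star a = a) :
    ∃ n : ℤ, a = n := by
  obtain ⟨n, hn⟩ := exists_norm_eq σ ha
  obtain ⟨w, rfl⟩ := ha
  set a : ℂ := σ (w : K)
  change star a = a at hs
  change _ = a * star a at hn
  have ht := cast_trace_eq σ w
  rw [show σ (w : K) = a from rfl, hs] at ht
  rw [hs] at hn
  set m := Algebra.trace ℤ (NumberField.RingOfIntegers K) w
  -- For real `a` the trace is `m = 2a` and the norm is `n = a²`; hence `4 ∣ m²`, so `m` is even and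
  -- `a = m/2` is an integer.
  have h1 : m ^ 2 = 2 ^ 2 * (n : ℤ) := by
    have : ((m ^ 2 : ℤ) : ℂ) = ((2 ^ 2 * (n : ℤ) : ℤ) : ℂ) := by
      push_cast
      rw [ht, hn]
      ring
    exact_mod_cast this
  obtain ⟨r, hr⟩ := (Int.pow_dvd_pow_iff two_ne_zero).mp (Dvd.intro _ h1.symm)
  refine ⟨r, ?_⟩
  change a = r
  rw [hr] at ht
  push_cast at ht
  linear_combination -(1 / 2 : ℂ) * ht

/-- For any `ℤ`-basis, `δ = z₁ conj(z₂) - z₂ conj(z₁)` is purely imaginary with `δ²` the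
discriminant, so `δ = ±i√D_K`. Swapping the basis vectors corrects the sign. -/
theorem exists_isOrientedBasis (σ : K →+* ℂ) : ∃ b₁ b₂ : ℂ, IsOrientedBasis σ b₁ b₂ := by
  classical
  have hrank : Module.finrank ℤ (NumberField.RingOfIntegers K) = 2 := by
    rw [NumberField.RingOfIntegers.rank, Algebra.IsQuadraticExtension.finrank_eq_two ℚ K]
  let b := Module.finBasisOfFinrankEq ℤ (NumberField.RingOfIntegers K) hrank
  set z₁ : ℂ := σ (b 0 : K) with hz₁
  set z₂ : ℂ := σ (b 1 : K) with hz₂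
  have hmem : ∀ a : ℂ, a ∈ integers σ ↔ ∃ x y : ℤ, a = x * z₁ + y * z₂ := by
    intro a
    constructor
    · rintro ⟨w, rfl⟩
      refine ⟨b.repr w 0, b.repr w 1, ?_⟩
      conv_lhs => rw [← b.sum_repr w]
      simp [Fin.sum_univ_two, hz₁, hz₂]
    · rintro ⟨x, y, rfl⟩
      exact ⟨x • b 0 + y • b 1, by simp [hz₁, hz₂]⟩
  set δ : ℂ := z₁ * star z₂ - z₂ * star z₁ with hδ
  have hdisc : (NumberField.discr K : ℂ) = δ ^ 2 := by
    rw [← NumberField.discr_eq_discr K b, Algebra.discr_def, Matrix.det_fin_two]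
    simp only [Algebra.traceMatrix_apply, Algebra.traceForm_apply]
    push_cast
    simp only [cast_trace_eq σ, map_mul, star_mul', ← hz₁, ← hz₂]
    rw [hδ]
    ring
  have hre : δ.re = 0 := by
    rw [hδ]; simp; ring
  have hδI : δ = Complex.I * (δ.im : ℂ) := by
    apply Complex.ext <;> simp [hre]
  have hdiscR : (NumberField.discr K : ℝ) = -(δ.im) ^ 2 := by
    have : ((NumberField.discr K : ℝ) : ℂ) = ((-(δ.im) ^ 2 : ℝ) : ℂ) := by
      push_cast
      rw [hdisc]
      conv_lhs => rw [hδI]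
      rw [mul_pow, Complex.I_sq]
      ring
    exact_mod_cast this
  have habs : Real.sqrt (absDisc K) = |δ.im| := by
    rw [absDisc, Nat.cast_natAbs, Int.cast_abs, hdiscR, abs_neg, abs_pow, sq_abs, Real.sqrt_sq_eq_abs]
  rcases abs_choice δ.im with h | h
  · exact ⟨z₁, z₂, hmem, by rw [habs, h, ← hδ, ← hδI]⟩
  · refine ⟨z₂, z₁, fun a => ?_, ?_⟩
    · rw [hmem]
      constructor
      · rintro ⟨x, y, rfl⟩; exact ⟨y, x, add_comm _ _⟩
      · rintro ⟨x, y, rfl⟩; exact ⟨y, x, add_comm _ _⟩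
    · rw [habs, h]
      push_cast
      rw [mul_neg, ← hδI, hδ]
      ring

end Coordinates

/-! ### The trace pairing between `𝒮` and the integral Hermitian matrices. -/

section Dual

variable {K : Type*} [Field K] [NumberField K] {σ : K →+* ℂ} {b₁ b₂ : ℂ}

/-- The Hermitian matrix with diagonal `v₀, v₁` and off-diagonal entry `v₂ b₁ + v₃ b₂`. -/
def hermMatrix (b₁ b₂ : ℂ) (v : Fin 4 → ℤ) : Mat2 :=
  !![(v 0 : ℂ), v 2 * b₁ + v 3 * b₂; star (v 2 * b₁ + v 3 * b₂), (v 1 : ℂ)]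

/-- The matrix in `𝒮` with diagonal `w₀, w₁` and off-diagonal entry
`(w₂ b₁ + w₃ b₂) / √(-D_K)`. -/
noncomputable def dualMatrix (K : Type*) [Field K] [NumberField K] (b₁ b₂ : ℂ) (w : Fin 4 → ℤ) : Mat2 :=
  !![(w 0 : ℂ), (w 2 * b₁ + w 3 * b₂) / (Complex.I * (Real.sqrt (absDisc K) : ℂ));
    star ((w 2 * b₁ + w 3 * b₂) / (Complex.I * (Real.sqrt (absDisc K) : ℂ))), (w 1 : ℂ)]

theorem IsOrientedBasis.mem_dualLattice_iff (hb : IsOrientedBasis σ b₁ b₂) (T : Mat2) :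
    T ∈ dualLattice σ ↔ ∃ w, T = dualMatrix K b₁ b₂ w := by
  constructor
  · rintro ⟨l, m, t, ⟨a, ha, rfl⟩, rfl⟩
    obtain ⟨x, y, rfl⟩ := (hb.mem_iff a).mp ha
    exact ⟨![l, m, x, y], by simp [dualMatrix]⟩
  · rintro ⟨w, rfl⟩
    exact ⟨w 0, w 1, _, ⟨_, (hb.mem_iff _).mpr ⟨w 2, w 3, rfl⟩, rfl⟩, rfl⟩

/-- With `r = √(-D_K)`, the off-diagonal entries `a/r` and `s` contribute `(a conj(s) - s
conj(a))/r`, an alternating form in `a, s`. The normalisation `area` makes it the determinant of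
their coordinates, so the pairing is integral and unimodular. -/
theorem IsOrientedBasis.trace_mul (hb : IsOrientedBasis σ b₁ b₂) (w v : Fin 4 → ℤ) :
    (dualMatrix K b₁ b₂ w * hermMatrix b₁ b₂ v).trace =
      ((w 0 * v 0 + w 1 * v 1 + w 2 * v 3 - w 3 * v 2 : ℤ) : ℂ) := by
  have h := hb.area
  have h0 : Complex.I * (Real.sqrt (absDisc K) : ℂ) ≠ 0 := area_ne_zero
  have hs : star (Complex.I * (Real.sqrt (absDisc K) : ℂ)) =
      -(Complex.I * (Real.sqrt (absDisc K) : ℂ)) := by simp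
  rw [dualMatrix, hermMatrix, Matrix.trace_fin_two, Matrix.mul_fin_two]
  simp only [Matrix.of_apply, Matrix.cons_val', Matrix.cons_val_zero, Matrix.cons_val_one,
    Matrix.cons_val_fin_one, star_div₀, hs, star_add, star_mul', star_intCast]
  generalize Complex.I * (Real.sqrt (absDisc K) : ℂ) = r at *
  subst h
  push_cast
  field_simp
  ring

/-- Cramer's rule for the relation and its complex conjugate: the determinant of the system is the
nonzero `area`. -/
theorem IsOrientedBasis.linearIndependent (hb : IsOrientedBasis σ b₁ b₂) {x y : ℝ}
    (h : x * b₁ + y * b₂ = 0) : x = 0 ∧ y = 0 := by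
  have h0 : b₁ * star b₂ - b₂ * star b₁ ≠ 0 := by rw [hb.area]; exact area_ne_zero
  have h' := congrArg star h
  simp only [star_add, star_mul', Complex.star_def, Complex.conj_ofReal, map_zero] at h' h0
  constructor
  · have : (x : ℂ) * (b₁ * star b₂ - b₂ * star b₁) = 0 := by
      simp only [Complex.star_def]
      linear_combination (starRingEnd ℂ) b₂ * h - b₂ * h'
    exact_mod_cast (mul_eq_zero.mp this).resolve_right h0
  · have : (y : ℂ) * (b₁ * star b₂ - b₂ * star b₁) = 0 := by
      simp only [Complex.star_def]
      linear_combination b₁ * h' - (starRingEnd ℂ) b₁ * h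
    exact_mod_cast (mul_eq_zero.mp this).resolve_right h0

end Dual

/-! ### The content of a matrix in `𝒮` -/

section Content

variable {K : Type*} [Field K] [NumberField K]

theorem add_mem_inverseDifferent (σ : K →+* ℂ) {s t : ℂ} (hs : s ∈ inverseDifferent σ)
    (ht : t ∈ inverseDifferent σ) : s + t ∈ inverseDifferent σ := by
  obtain ⟨a, ha, rfl⟩ := hs
  obtain ⟨b, hb, rfl⟩ := ht
  exact ⟨a + b, add_mem ha hb, by rw [add_div]⟩

theorem add_mem_dualLattice (σ : K →+* ℂ) {S T : Mat2} (hS : S ∈ dualLattice σ)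
    (hT : T ∈ dualLattice σ) : S + T ∈ dualLattice σ := by
  obtain ⟨l, m, s, hs, rfl⟩ := hS
  obtain ⟨l', m', t, ht, rfl⟩ := hT
  refine ⟨l + l', m + m', s + t, add_mem_inverseDifferent σ hs ht, ?_⟩
  ext i j; fin_cases i <;> fin_cases j <;> simp

theorem zsmul_mem_dualLattice (σ : K →+* ℂ) {T : Mat2} (n : ℤ) (hT : T ∈ dualLattice σ) :
    (n : ℂ) • T ∈ dualLattice σ := by
  obtain ⟨l, m, _, ⟨a, ha, rfl⟩, rfl⟩ := hT
  refine ⟨n * l, n * m, _, ⟨n * a, mul_mem (intCast_mem _ n) ha, rfl⟩, ?_⟩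
  ext i j; fin_cases i <;> fin_cases j <;> simp [mul_div_assoc]

/-- With a Bézout relation `1 = du + pv`, one has `T/d = v(pT/d) + uT`. -/
theorem inv_smul_smul_mem_dualLattice_iff (σ : K →+* ℂ) {T : Mat2} (hT : T ∈ dualLattice σ)
    {d p : ℕ} (hd : 0 < d) (hdp : d.Coprime p) :
    (d : ℂ)⁻¹ • (p : ℂ) • T ∈ dualLattice σ ↔ (d : ℂ)⁻¹ • T ∈ dualLattice σ := by
  constructor
  · intro h
    have h1 := add_mem_dualLattice σ (zsmul_mem_dualLattice σ (Nat.gcdB d p) h)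
      (zsmul_mem_dualLattice σ (Nat.gcdA d p) hT)
    have h2 : (1 : ℂ) = d * Nat.gcdA d p + p * Nat.gcdB d p := by
      have := Nat.gcd_eq_gcd_ab d p
      rw [hdp.gcd_eq_one] at this
      exact_mod_cast this
    rw [smul_smul, smul_smul, ← add_smul] at h1
    have hd' : (d : ℂ) ≠ 0 := Nat.cast_ne_zero.mpr hd.ne'
    have h3 : (Nat.gcdB d p : ℂ) * ((d : ℂ)⁻¹ * p) + Nat.gcdA d p = (d : ℂ)⁻¹ := by
      field_simp
      linear_combination -h2
    rwa [mul_assoc, h3] at h1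
  · intro h
    rw [smul_comm]
    exact_mod_cast zsmul_mem_dualLattice σ p h

variable [Algebra.IsQuadraticExtension ℚ K] [NumberField.IsTotallyComplex K]

/-- Any admissible `q` divides every coordinate of `T`, and some coordinate is nonzero. The bound
makes the `sSup` in `content` a genuine maximum. -/
theorem bddAbove_content (σ : K →+* ℂ) {T : Mat2} (hT : T ∈ dualLattice σ) (hT0 : T ≠ 0) :
    BddAbove {q : ℕ | 0 < q ∧ (q : ℂ)⁻¹ • T ∈ dualLattice σ} := by
  obtain ⟨b₁, b₂, hb⟩ := exists_isOrientedBasis σ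
  obtain ⟨w, rfl⟩ := (hb.mem_dualLattice_iff T).mp hT
  have hw : ∃ i, w i ≠ 0 := by
    by_contra! h
    apply hT0
    ext i j; fin_cases i <;> fin_cases j <;> simp [dualMatrix, h]
  obtain ⟨i, hi⟩ := hw
  refine ⟨(w i).natAbs, ?_⟩
  rintro q ⟨hq, hqT⟩
  obtain ⟨u, hu⟩ := (hb.mem_dualLattice_iff _).mp hqT
  have hq0 : (q : ℂ) ≠ 0 := Nat.cast_ne_zero.mpr hq.ne'
  have hu' : dualMatrix K b₁ b₂ w = (q : ℂ) • dualMatrix K b₁ b₂ u := by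
    rw [← hu, smul_smul, mul_inv_cancel₀ hq0, one_smul]
  have hall : ∀ j, w j = q * u j := by
    have h00 := congrFun (congrFun hu' 0) 0
    have h11 := congrFun (congrFun hu' 1) 1
    have h01 := congrFun (congrFun hu' 0) 1
    simp only [dualMatrix, Matrix.of_apply, Matrix.cons_val', Matrix.cons_val_zero,
      Matrix.cons_val_one, Matrix.cons_val_fin_one, Matrix.smul_apply, smul_eq_mul] at h00 h11 h01
    rw [← mul_div_assoc, div_left_inj' area_ne_zero] at h01
    have h23 := hb.linearIndependent (x := w 2 - q * u 2) (y := w 3 - q * u 3)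
      (by push_cast; linear_combination h01)
    intro j
    fin_cases j
    · exact_mod_cast h00
    · exact_mod_cast h11
    · exact_mod_cast sub_eq_zero.mp h23.1
    · exact_mod_cast sub_eq_zero.mp h23.2
  exact Nat.le_of_dvd (Int.natAbs_pos.mpr hi) (Int.natCast_dvd.mp ⟨u i, hall i⟩)

/-- The admissible `q` are closed under divisors and under least common multiples, so the largest
one is a multiple of all of them. -/
theorem dvd_content_iff (σ : K →+* ℂ) {T : Mat2} (hT : T ∈ dualLattice σ) (hT0 : T ≠ 0) {d : ℕ} :
    d ∈ (content σ T).divisors ↔ 0 < d ∧ (d : ℂ)⁻¹ • T ∈ dualLattice σ := by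
  have hbdd := bddAbove_content σ hT hT0
  have hmem : content σ T ∈ {q : ℕ | 0 < q ∧ (q : ℂ)⁻¹ • T ∈ dualLattice σ} :=
    Nat.sSup_mem ⟨1, one_pos, by simpa using hT⟩ hbdd
  obtain ⟨hc, hcT⟩ := hmem
  rw [Nat.mem_divisors, and_iff_left hc.ne']
  constructor
  · rintro ⟨f, hf⟩
    have hd : 0 < d := Nat.pos_of_mul_pos_right (hf ▸ hc)
    have hf0 : 0 < f := Nat.pos_of_mul_pos_left (hf ▸ hc)
    refine ⟨hd, ?_⟩
    have h := zsmul_mem_dualLattice σ f hcT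
    rw [smul_smul, hf] at h
    have hd' : (d : ℂ) ≠ 0 := Nat.cast_ne_zero.mpr hd.ne'
    have hf' : (f : ℂ) ≠ 0 := Nat.cast_ne_zero.mpr hf0.ne'
    have h2 : ((f : ℤ) : ℂ) * ((d * f : ℕ) : ℂ)⁻¹ = (d : ℂ)⁻¹ := by
      push_cast; field_simp
    rwa [h2] at h
  · rintro ⟨hd, hdT⟩
    set c := content σ T with hcdef
    have hlcm : Nat.lcm d c ∈ {q : ℕ | 0 < q ∧ (q : ℂ)⁻¹ • T ∈ dualLattice σ} := by
      refine ⟨Nat.lcm_pos hd hc, ?_⟩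
      have h := add_mem_dualLattice σ (zsmul_mem_dualLattice σ (Nat.gcdB d c) hdT)
        (zsmul_mem_dualLattice σ (Nat.gcdA d c) hcT)
      rw [smul_smul, smul_smul, ← add_smul] at h
      have hd' : (d : ℂ) ≠ 0 := Nat.cast_ne_zero.mpr hd.ne'
      have hc' : (c : ℂ) ≠ 0 := Nat.cast_ne_zero.mpr hc.ne'
      have hl' : (Nat.lcm d c : ℂ) ≠ 0 := Nat.cast_ne_zero.mpr (Nat.lcm_pos hd hc).ne'
      have h1 : (Nat.gcd d c : ℂ) * Nat.lcm d c = d * c := by exact_mod_cast Nat.gcd_mul_lcm d c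
      have h2 : (Nat.gcd d c : ℂ) = d * Nat.gcdA d c + c * Nat.gcdB d c := by
        exact_mod_cast Nat.gcd_eq_gcd_ab d c
      -- Bézout divided by `dc`: `1/lcm(d,c) = gcd(d,c)/(dc)` is an integral combination of `1/d`
      -- and `1/c`.
      have h3 : (Nat.gcdB d c : ℂ) * (d : ℂ)⁻¹ + Nat.gcdA d c * (c : ℂ)⁻¹ =
          (Nat.lcm d c : ℂ)⁻¹ := by
        field_simp
        rw [h2] at h1
        linear_combination h1
      rwa [h3] at h
    have hle : Nat.lcm d c ≤ c := le_csSup hbdd hlcm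
    have heq : Nat.lcm d c = c := Nat.le_antisymm hle (Nat.le_of_dvd (Nat.lcm_pos hd hc) (Nat.dvd_lcm_right d c))
    exact heq ▸ Nat.dvd_lcm_left d c

/-- The determinant has degree 2. The comparison is made in `ℂ`, where `cast_detIndex` removes the
rounding. -/
theorem detIndex_smul (σ : K →+* ℂ) {T : Mat2} {d : ℕ} (p : ℕ)
    (hT : (d : ℂ)⁻¹ • T ∈ dualLattice σ) (hpos : T.PosSemidef) :
    detIndex K ((p : ℂ) • T) d = p ^ 2 * detIndex K T d := by
  have h1 : (d : ℂ)⁻¹ • (p : ℂ) • T ∈ dualLattice σ := by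
    rw [smul_comm]
    exact_mod_cast zsmul_mem_dualLattice σ p hT
  have h2 : ((p : ℂ) • T).PosSemidef := hpos.smul (Nat.cast_nonneg p)
  have h3 : (detIndex K ((p : ℂ) • T) d : ℂ) = ((p ^ 2 * detIndex K T d : ℕ) : ℂ) := by
    rw [cast_detIndex σ h1 h2]
    push_cast
    rw [cast_detIndex σ hT hpos, Matrix.det_smul, Fintype.card_fin]
    ring
  exact_mod_cast h3

end Content

end HermitianMaass

namespace HermitianMaass

open Matrix

/-! ### Coset representatives -/

section Unipotent

/-- The matrix `[[1, B], [0, 1]]`. -/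
def unipotent (B : Mat2) : GL4 where
  val := fromBlocks 1 B 0 1
  inv := fromBlocks 1 (-B) 0 1
  val_inv := by simp [fromBlocks_multiply]
  inv_val := by simp [fromBlocks_multiply]

theorem coe_unipotent (B : Mat2) : (unipotent B).1 = fromBlocks 1 B 0 1 := rfl

theorem unipotent_mul (A B : Mat2) : unipotent A * unipotent B = unipotent (A + B) := by
  apply Units.ext
  rw [Units.val_mul]
  simp [coe_unipotent, fromBlocks_multiply, add_comm]

theorem unipotent_inv (B : Mat2) : (unipotent B)⁻¹ = unipotent (-B) :=
  Units.ext rfl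

theorem coe_diagP (p : ℕ) [Fact p.Prime] :
    (diagP p).1 = fromBlocks 1 0 0 ((p : ℂ) • (1 : Mat2)) := rfl

theorem isSimilitude_unipotent {B : Mat2} (hB : B.IsHermitian) : IsSimilitude (unipotent B) 1 := by
  refine ⟨one_pos, ?_⟩
  simp [coe_unipotent, Matrix.J, fromBlocks_conjTranspose, fromBlocks_multiply, hB.eq]

theorem IsSimilitude.inv {g : GL4} {c : ℝ} (hg : IsSimilitude g c) : IsSimilitude g⁻¹ c⁻¹ := by
  refine ⟨inv_pos.mpr hg.1, ?_⟩
  have hc : (c : ℂ) ≠ 0 := Complex.ofReal_ne_zero.mpr hg.1.ne'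
  have h1 : g.1 * (g⁻¹).1 = 1 := by rw [← Units.val_mul, mul_inv_cancel]; rfl
  calc (g⁻¹).1ᴴ * Matrix.J (Fin 2) ℂ * (g⁻¹).1
      = (c : ℂ)⁻¹ • ((g⁻¹).1ᴴ * ((c : ℂ) • Matrix.J (Fin 2) ℂ) * (g⁻¹).1) := by
        rw [Matrix.mul_smul, Matrix.smul_mul, smul_smul, inv_mul_cancel₀ hc, one_smul]
    _ = (c : ℂ)⁻¹ • ((g.1 * (g⁻¹).1)ᴴ * Matrix.J (Fin 2) ℂ * (g.1 * (g⁻¹).1)) := by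
        rw [← hg.2]
        simp only [Matrix.conjTranspose_mul, Matrix.mul_assoc]
    _ = _ := by rw [h1]; simp

/-- `blocks` relates the block columns of `g`; this relation concerns its rows. A left inverse of
`g` is also a right inverse, so `gᴴJg = J` implies `gJgᴴ = J`. -/
theorem IsSimilitude.mul_conjTranspose {g : GL4} (hg : IsSimilitude g 1) :
    g.1.toBlocks₁₁ * g.1.toBlocks₁₂ᴴ = g.1.toBlocks₁₂ * g.1.toBlocks₁₁ᴴ := by
  have h1 : -(Matrix.J (Fin 2) ℂ * g.1ᴴ * Matrix.J (Fin 2) ℂ) * g.1 = 1 := by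
    calc _ = -(Matrix.J (Fin 2) ℂ * (g.1ᴴ * Matrix.J (Fin 2) ℂ * g.1)) := by
          simp only [Matrix.neg_mul, Matrix.mul_assoc]
      _ = 1 := by rw [hg.2, Complex.ofReal_one, one_smul, Matrix.J_squared, neg_neg]
  have h2 := mul_eq_one_comm.mp h1
  have h3 : g.1 * Matrix.J (Fin 2) ℂ * g.1ᴴ = Matrix.J (Fin 2) ℂ := by
    calc _ = (g.1 * -(Matrix.J (Fin 2) ℂ * g.1ᴴ * Matrix.J (Fin 2) ℂ)) * Matrix.J (Fin 2) ℂ := by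
          simp only [Matrix.neg_mul, Matrix.mul_neg, Matrix.mul_assoc, Matrix.J_squared,
            Matrix.mul_one, neg_neg]
      _ = _ := by rw [h2, Matrix.one_mul]
  rw [← Matrix.fromBlocks_toBlocks g.1] at h3
  simp only [Matrix.J, Matrix.fromBlocks_conjTranspose, Matrix.fromBlocks_multiply] at h3
  obtain ⟨h4, -, -, -⟩ := Matrix.fromBlocks_inj.mp h3
  simp only [Matrix.mul_zero, Matrix.mul_one, Matrix.mul_neg, Matrix.neg_mul, zero_add, add_zero,
    ← sub_eq_add_neg] at h4
  exact (sub_eq_zero.mp h4).symm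

theorem diagP_mul_unipotent (p : ℕ) [Fact p.Prime] (B : Mat2) :
    diagP p * unipotent B = unipotent ((p : ℂ)⁻¹ • B) * diagP p := by
  have hp : (p : ℂ) ≠ 0 := Nat.cast_ne_zero.mpr (Fact.out : p.Prime).ne_zero
  apply Units.ext
  rw [Units.val_mul, Units.val_mul, coe_diagP, coe_unipotent, coe_unipotent, fromBlocks_multiply,
    fromBlocks_multiply]
  simp [smul_smul, hp]

theorem slash_diagP_mul_unipotent (p : ℕ) [Fact p.Prime] (k : ℕ) (B : Mat2) (F : Mat2 → ℂ)
    (Z : Mat2) :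
    slash k (diagP p * unipotent B) F Z =
      ((p : ℂ) ^ (2 * k))⁻¹ * F ((p : ℂ)⁻¹ • (Z + B)) := by
  have hp : (p : ℂ) ≠ 0 := Nat.cast_ne_zero.mpr (Fact.out : p.Prime).ne_zero
  have h : (diagP p * unipotent B).1 = fromBlocks 1 B 0 ((p : ℂ) • 1) := by
    rw [Units.val_mul, coe_diagP, coe_unipotent, fromBlocks_multiply]
    simp
  have hn : num (diagP p * unipotent B) Z = Z + B := by simp [num, h]
  have hd : den (diagP p * unipotent B) Z = (p : ℂ) • 1 := by simp [den, h]
  have hinv : ((p : ℂ) • (1 : Mat2))⁻¹ = (p : ℂ)⁻¹ • 1 :=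
    Matrix.inv_eq_right_inv (by simp [smul_smul, hp])
  rw [slash_eq, moebius, hn, hd, hinv, Matrix.mul_smul, Matrix.mul_one, Matrix.det_smul]
  simp [pow_mul]

end Unipotent

/-! ### Reduction of the cosets in the double coset to upper triangular form. -/

section Cosets

variable {K : Type*} [Field K] [NumberField K]
  [Algebra.IsQuadraticExtension ℚ K] [NumberField.IsTotallyComplex K]
  {σ : K →+* ℂ} {N p : ℕ}

theorem conjTranspose_mem_matrix {M : Mat2} (hM : M ∈ (integers σ).matrix) :
    Mᴴ ∈ (integers σ).matrix :=
  fun i j => star_mem_integers σ (hM j i)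

theorem mem_Gamma0_of_fromBlocks {g : GL4} {a b c d : Mat2}
    (hg : g.1 = fromBlocks a b ((N : ℂ) • c) d) (ha : a ∈ (integers σ).matrix)
    (hb : b ∈ (integers σ).matrix) (hc : c ∈ (integers σ).matrix)
    (hd : d ∈ (integers σ).matrix) (hs : IsSimilitude g 1) : g ∈ Gamma0 σ N := by
  refine ⟨fun i j => ?_, by simpa using hs.2, fun i j => ⟨c i j, hc i j, by rw [hg]; rfl⟩⟩
  rw [hg]
  rcases i with i | i <;> rcases j with j | j
  · exact ha i j
  · exact hb i j
  · exact mul_mem (natCast_mem _ N) (hc i j)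
  · exact hd i j

theorem unipotent_mem_Gamma0_iff {B : Mat2} (hB : B.IsHermitian) :
    unipotent B ∈ Gamma0 σ N ↔ B ∈ (integers σ).matrix :=
  ⟨fun h i j => h.1 (Sum.inl i) (Sum.inr j), fun h =>
    mem_Gamma0_of_fromBlocks (c := 0) (by rw [coe_unipotent, smul_zero]) (one_mem _) h
      (zero_mem _) (one_mem _) (isSimilitude_unipotent hB)⟩

variable [Fact p.Prime]

/-- Conjugation by `diag(1,1,p,p)` divides the upper right block by `p`, so the quotient of the two
representatives is `unipotent ((B - A)/p)`. -/
theorem mk_diagP_mul_unipotent_eq_iff {A B : Mat2} (hA : A.IsHermitian) (hB : B.IsHermitian) :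
    (Quotient.mk (QuotientGroup.rightRel (Gamma0 σ N)) (diagP p * unipotent A) =
      Quotient.mk _ (diagP p * unipotent B)) ↔ (p : ℂ)⁻¹ • (B - A) ∈ (integers σ).matrix := by
  have hH : ((p : ℂ)⁻¹ • (B - A)).IsHermitian := by
    rw [IsHermitian, conjTranspose_smul, (hB.sub hA).eq]
    simp
  rw [Quotient.eq, QuotientGroup.rightRel_apply, ← unipotent_mem_Gamma0_iff (N := N) hH]
  have : diagP p * unipotent B * (diagP p * unipotent A)⁻¹ = unipotent ((p : ℂ)⁻¹ • (B - A)) := by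
    rw [_root_.mul_inv_rev, unipotent_inv, mul_assoc, ← mul_assoc (unipotent B), unipotent_mul,
      ← mul_assoc, diagP_mul_unipotent, mul_inv_cancel_right, sub_eq_add_neg]
  rw [this]

/-- Conjugation by `diag(1, 1, p, p)` preserves `Γ₀(N)` on the matrices whose upper right block is
divisible by `p`. -/
theorem diagP_conj_mem_Gamma0 {g : GL4} (hg : g ∈ Gamma0 σ N) {b : Mat2}
    (hb : b ∈ (integers σ).matrix) (hgb : g.1.toBlocks₁₂ = (p : ℂ) • b) :
    diagP p * g * (diagP p)⁻¹ ∈ Gamma0 σ N := by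
  have hp : (p : ℂ) ≠ 0 := Nat.cast_ne_zero.mpr (Fact.out : p.Prime).ne_zero
  choose c hc hgc using hg.2.2
  have hgc' : g.1.toBlocks₂₁ = (N : ℂ) • (of c : Mat2) := by
    ext i j; exact hgc i j
  have hs : IsSimilitude (diagP p * g * (diagP p)⁻¹) 1 := by
    have hp0 : (p : ℝ) ≠ 0 := Nat.cast_ne_zero.mpr (Fact.out : p.Prime).ne_zero
    simpa [hp0] using ((isSimilitude_diagP p).mul (isSimilitude_of_mem_Gamma0 hg)).mul
      (isSimilitude_diagP p).inv
  have hinv : ((diagP p)⁻¹).1 = fromBlocks 1 0 0 ((p : ℂ)⁻¹ • (1 : Mat2)) := by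
    refine Units.inv_eq_of_mul_eq_one_left ?_
    rw [coe_diagP, fromBlocks_multiply]
    simp [smul_smul, hp]
  refine mem_Gamma0_of_fromBlocks (a := g.1.toBlocks₁₁) (b := b) (c := (p : ℂ) • (of c : Mat2))
    (d := g.1.toBlocks₂₂) ?_ (fun i j => hg.1 _ _) hb
    (fun i j => mul_mem (S := Subring ℂ) (natCast_mem (integers σ) p) (hc i j)) (fun i j => hg.1 _ _) hs
  rw [Units.val_mul, Units.val_mul, hinv, coe_diagP]
  conv_lhs => rw [← fromBlocks_toBlocks g.1]
  rw [fromBlocks_multiply, fromBlocks_multiply, hgb, hgc']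
  simp [smul_smul, hp, mul_comm]

theorem exists_mk_eq_of_mem_doubleCoset (hpN : p ∣ N) {g : GL4}
    (hg : g ∈ DoubleCoset.doubleCoset (diagP p) (Gamma0 σ N : Set GL4) (Gamma0 σ N)) :
    ∃ B : Mat2, B.IsHermitian ∧ B ∈ (integers σ).matrix ∧
      Quotient.mk (QuotientGroup.rightRel (Gamma0 σ N)) (diagP p * unipotent B) =
        Quotient.mk _ g := by
  obtain ⟨x, hx, y, hy, rfl⟩ := DoubleCoset.mem_doubleCoset.mp hg
  obtain ⟨h1, h2, h3, h4⟩ := (isSimilitude_of_mem_Gamma0 hy).blocks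
  have h5 := (isSimilitude_of_mem_Gamma0 hy).mul_conjTranspose
  obtain ⟨M, rfl⟩ := hpN
  choose c hc hyc using hy.2.2
  have hyc' : y.1.toBlocks₂₁ = (p : ℂ) • ((M : ℂ) • (of c : Mat2)) := by
    ext i j
    exact (hyc i j).trans (by simp [mul_assoc])
  have hA : y.1.toBlocks₁₁ ∈ (integers σ).matrix := fun i j => hy.1 _ _
  have hB : y.1.toBlocks₁₂ ∈ (integers σ).matrix := fun i j => hy.1 _ _
  have hD : y.1.toBlocks₂₂ ∈ (integers σ).matrix := fun i j => hy.1 _ _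
  have hC : (M : ℂ) • (of c : Mat2) ∈ (integers σ).matrix :=
    fun i j => mul_mem (S := Subring ℂ) (natCast_mem (integers σ) M) (hc i j)
  have hHerm : (y.1.toBlocks₁₂ᴴ * y.1.toBlocks₂₂).IsHermitian := by
    rw [IsHermitian, conjTranspose_mul, conjTranspose_conjTranspose, h4]
  have hint := mul_mem (conjTranspose_mem_matrix hB) hD
  -- For `y = [[A, B], [C, D]]` the witness is `BᴴD = DᴴB`. Modulo `p` the block `C` vanishes and
  -- `Dᴴ` inverts `A`, so this is `A⁻¹B`, which is what clears the upper right block of `y`.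
  refine ⟨_, hHerm, hint, ?_⟩
  rw [Quotient.eq, QuotientGroup.rightRel_apply]
  have hz := mul_mem hy (inv_mem ((unipotent_mem_Gamma0_iff (σ := σ) (N := p * M) hHerm).mpr hint))
  have hfac : x * diagP p * y * (diagP p * unipotent (y.1.toBlocks₁₂ᴴ * y.1.toBlocks₂₂))⁻¹ =
      x * (diagP p * (y * (unipotent (y.1.toBlocks₁₂ᴴ * y.1.toBlocks₂₂))⁻¹) * (diagP p)⁻¹) := by
    group
  rw [hfac]
  refine mul_mem hx (diagP_conj_mem_Gamma0 hz (neg_mem (mul_mem (mul_mem hB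
    (conjTranspose_mem_matrix hC)) hB)) ?_)
  have hblk : (y * (unipotent (y.1.toBlocks₁₂ᴴ * y.1.toBlocks₂₂))⁻¹).1.toBlocks₁₂ =
      y.1.toBlocks₁₂ - y.1.toBlocks₁₁ * (y.1.toBlocks₁₂ᴴ * y.1.toBlocks₂₂) := by
    rw [Units.val_mul, unipotent_inv, coe_unipotent]
    conv_lhs => rw [← fromBlocks_toBlocks y.1]
    rw [fromBlocks_multiply, toBlocks_fromBlocks₁₂, Matrix.mul_one, Matrix.mul_neg]
    simp only [toBlocks_fromBlocks₁₂, toBlocks_fromBlocks₂₂]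
    abel
  -- `B - ABᴴD = B - BAᴴD = B - B(1 + CᴴB) = -BCᴴB`, which is divisible by `p` because `C` is.
  rw [hblk, ← Matrix.mul_assoc, h5, Matrix.mul_assoc, h2, hyc', Matrix.mul_add, Complex.ofReal_one,
    one_smul, Matrix.mul_one, sub_add_cancel_left, conjTranspose_smul, star_natCast,
    Matrix.smul_mul, Matrix.mul_smul, smul_neg, Matrix.mul_assoc]

end Cosets

/-! ### Integral Hermitian matrices modulo `p` as a complete set of representatives. -/

section Representatives

variable {K : Type*} [Field K] [NumberField K] {σ : K →+* ℂ} {b₁ b₂ : ℂ} {N p : ℕ}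

theorem isHermitian_hermMatrix (b₁ b₂ : ℂ) (v : Fin 4 → ℤ) : (hermMatrix b₁ b₂ v).IsHermitian := by
  ext i j; fin_cases i <;> fin_cases j <;> simp [hermMatrix]

theorem hermMatrix_sub (b₁ b₂ : ℂ) (v w : Fin 4 → ℤ) :
    hermMatrix b₁ b₂ v - hermMatrix b₁ b₂ w = hermMatrix b₁ b₂ (v - w) := by
  ext i j; fin_cases i <;> fin_cases j <;> simp [hermMatrix] <;> ring

variable [Algebra.IsQuadraticExtension ℚ K] [NumberField.IsTotallyComplex K]

theorem IsOrientedBasis.hermMatrix_mem (hb : IsOrientedBasis σ b₁ b₂) (v : Fin 4 → ℤ) :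
    hermMatrix b₁ b₂ v ∈ (integers σ).matrix := by
  have h := (hb.mem_iff _).mpr ⟨v 2, v 3, rfl⟩
  intro i j
  fin_cases i <;> fin_cases j
  · exact intCast_mem (integers σ) _
  · exact h
  · exact star_mem_integers σ h
  · exact intCast_mem (integers σ) _

theorem IsOrientedBasis.exists_hermMatrix_eq (hb : IsOrientedBasis σ b₁ b₂) {B : Mat2}
    (hB : B.IsHermitian) (hint : B ∈ (integers σ).matrix) : ∃ v, B = hermMatrix b₁ b₂ v := by
  obtain ⟨l, hl⟩ := exists_int_eq_of_star_eq σ (hint 0 0) (hB.apply 0 0)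
  obtain ⟨m, hm⟩ := exists_int_eq_of_star_eq σ (hint 1 1) (hB.apply 1 1)
  obtain ⟨x, y, hxy⟩ := (hb.mem_iff _).mp (hint 0 1)
  refine ⟨![l, m, x, y], ?_⟩
  have h10 := (hB.apply 1 0).symm
  rw [hxy] at h10
  ext i j
  fin_cases i <;> fin_cases j
  · exact hl
  · exact hxy
  · exact h10
  · exact hm

variable [Fact p.Prime]

theorem IsOrientedBasis.inv_smul_hermMatrix_mem_iff (hb : IsOrientedBasis σ b₁ b₂)
    (v : Fin 4 → ℤ) :
    (p : ℂ)⁻¹ • hermMatrix b₁ b₂ v ∈ (integers σ).matrix ↔ ∀ i, (p : ℤ) ∣ v i := by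
  have hp : (p : ℂ) ≠ 0 := Nat.cast_ne_zero.mpr (Fact.out : p.Prime).ne_zero
  constructor
  · intro h
    have hH : ((p : ℂ)⁻¹ • hermMatrix b₁ b₂ v).IsHermitian := by
      rw [IsHermitian, conjTranspose_smul, (isHermitian_hermMatrix b₁ b₂ v).eq]
      simp
    obtain ⟨u, hu⟩ := hb.exists_hermMatrix_eq hH h
    have hu' : hermMatrix b₁ b₂ v = (p : ℂ) • hermMatrix b₁ b₂ u := by
      rw [← hu, smul_smul, mul_inv_cancel₀ hp, one_smul]
    have h00 := congrFun (congrFun hu' 0) 0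
    have h11 := congrFun (congrFun hu' 1) 1
    have h01 := congrFun (congrFun hu' 0) 1
    simp only [hermMatrix, Matrix.of_apply, Matrix.cons_val', Matrix.cons_val_zero,
      Matrix.cons_val_one, Matrix.cons_val_fin_one, Matrix.smul_apply, smul_eq_mul] at h00 h11 h01
    have h23 := hb.linearIndependent (x := v 2 - p * u 2) (y := v 3 - p * u 3)
      (by push_cast; linear_combination h01)
    intro i
    refine ⟨u i, ?_⟩
    fin_cases i
    · exact_mod_cast h00
    · exact_mod_cast h11
    · exact_mod_cast sub_eq_zero.mp h23.1
    · exact_mod_cast sub_eq_zero.mp h23.2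
  · intro h
    choose u hu using h
    have : (p : ℂ)⁻¹ • hermMatrix b₁ b₂ v = hermMatrix b₁ b₂ u := by
      rw [inv_smul_eq_iff₀ hp]
      ext i j
      fin_cases i <;> fin_cases j <;> simp [hermMatrix, hu] <;> ring
    rw [this]
    exact hb.hermMatrix_mem u

/-- Representatives for the integral Hermitian matrices modulo `p`. -/
def hermRep (b₁ b₂ : ℂ) {p : ℕ} (v : Fin 4 → ZMod p) : Mat2 :=
  hermMatrix b₁ b₂ fun i => (v i).cast

/-- The cosets in `Γ diag(1,1,p,p) Γ`, for `p ∣ N`, are represented by the matrices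
`[[1, B], [0, p]]` with `B` running over the integral Hermitian matrices modulo `p`. -/
theorem IsOrientedBasis.heckeCosets_eq_range (hb : IsOrientedBasis σ b₁ b₂) (hpN : p ∣ N) :
    heckeCosets σ N p = Set.range fun v : Fin 4 → ZMod p =>
      Quotient.mk (QuotientGroup.rightRel (Gamma0 σ N)) (diagP p * unipotent (hermRep b₁ b₂ v)) := by
  ext q
  constructor
  · rintro ⟨g, hg, rfl⟩
    obtain ⟨B, hB, hint, h⟩ := exists_mk_eq_of_mem_doubleCoset hpN hg
    obtain ⟨v, rfl⟩ := hb.exists_hermMatrix_eq hB hint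
    refine ⟨fun i => v i, ?_⟩
    rw [← h]
    change Quotient.mk _ (diagP p * unipotent (hermMatrix b₁ b₂ _)) = Quotient.mk _ _
    rw [mk_diagP_mul_unipotent_eq_iff (isHermitian_hermMatrix _ _ _) hB, hermMatrix_sub,
      hb.inv_smul_hermMatrix_mem_iff]
    intro i
    rw [Pi.sub_apply, ← ZMod.intCast_eq_intCast_iff_dvd_sub, ZMod.intCast_zmod_cast]
  · rintro ⟨v, rfl⟩
    refine ⟨_, DoubleCoset.mem_doubleCoset.mpr ⟨1, one_mem _, unipotent (hermRep b₁ b₂ v), ?_, ?_⟩, rfl⟩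
    · exact (unipotent_mem_Gamma0_iff (isHermitian_hermMatrix _ _ _)).mpr (hb.hermMatrix_mem _)
    · rw [one_mul]

theorem IsOrientedBasis.injective_mk_hermRep (hb : IsOrientedBasis σ b₁ b₂) :
    Function.Injective fun v : Fin 4 → ZMod p =>
      Quotient.mk (QuotientGroup.rightRel (Gamma0 σ N)) (diagP p * unipotent (hermRep b₁ b₂ v)) := by
  intro v w h
  change Quotient.mk _ (diagP p * unipotent (hermMatrix b₁ b₂ _)) =
    Quotient.mk _ (diagP p * unipotent (hermMatrix b₁ b₂ _)) at h
  rw [mk_diagP_mul_unipotent_eq_iff (isHermitian_hermMatrix _ _ _) (isHermitian_hermMatrix _ _ _),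
    hermMatrix_sub, hb.inv_smul_hermMatrix_mem_iff] at h
  funext i
  have hi := h i
  rw [Pi.sub_apply, ← ZMod.intCast_eq_intCast_iff_dvd_sub, ZMod.intCast_zmod_cast,
    ZMod.intCast_zmod_cast] at hi
  exact hi

theorem IsOrientedBasis.heckeU_eq_sum (hb : IsOrientedBasis σ b₁ b₂) (hpN : p ∣ N) {k : ℕ}
    {F : Mat2 → ℂ} (hF : F ∈ modularForms σ N k) {Z : Mat2} (hZ : Z ∈ upperHalfSpace) :
    heckeU σ N k p F Z = ((p : ℂ) ^ (2 * k))⁻¹ *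
      ∑ v : Fin 4 → ZMod p, F ((p : ℂ)⁻¹ • (Z + hermRep b₁ b₂ v)) := by
  unfold heckeU
  rw [hb.heckeCosets_eq_range hpN, finsum_mem_range hb.injective_mk_hermRep,
    finsum_eq_sum_of_fintype, Finset.mul_sum]
  refine Finset.sum_congr rfl fun v _ => ?_
  rw [← slash_diagP_mul_unipotent]
  exact slash_congr_coset hF ((isSimilitude_diagP p).mul
    (isSimilitude_unipotent (isHermitian_hermMatrix _ _ _))) (Quotient.out_eq _) hZ

end Representatives

end HermitianMaass

namespace HermitianMaass

open Matrix

variable {K : Type*} [Field K] [NumberField K] {σ : K →+* ℂ} {b₁ b₂ : ℂ} {N p k : ℕ}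

/-! ### Character sums -/

theorem e_add (x y : ℂ) : e (x + y) = e x * e y := by
  rw [e, mul_add, Complex.exp_add]; rfl

theorem e_intCast (n : ℤ) : e n = 1 := by
  rw [e, mul_comm]; exact Complex.exp_int_mul_two_pi_mul_I n

theorem IsOrientedBasis.e_trace_mul_hermMatrix (hb : IsOrientedBasis σ b₁ b₂) {T : Mat2}
    (hT : T ∈ dualLattice σ) (v : Fin 4 → ℤ) : e (T * hermMatrix b₁ b₂ v).trace = 1 := by
  obtain ⟨w, rfl⟩ := (hb.mem_dualLattice_iff T).mp hT
  rw [hb.trace_mul, e_intCast]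

theorem inv_smul_dualMatrix_mem (hb : IsOrientedBasis σ b₁ b₂) (hp : p ≠ 0) {w : Fin 4 → ℤ}
    (hw : ∀ i, (p : ℤ) ∣ w i) : (p : ℂ)⁻¹ • dualMatrix K b₁ b₂ w ∈ dualLattice σ := by
  choose u hu using hw
  refine (hb.mem_dualLattice_iff _).mpr ⟨u, ?_⟩
  have hp' : (p : ℂ) ≠ 0 := Nat.cast_ne_zero.mpr hp
  rw [inv_smul_eq_iff₀ hp']
  ext i j
  fin_cases i <;> fin_cases j <;> simp [dualMatrix, hu] <;> ring

/-- Orthogonality of characters on the integral Hermitian matrices modulo `p`. -/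
theorem IsOrientedBasis.sum_e_eq_zero [Fact p.Prime] (hb : IsOrientedBasis σ b₁ b₂) {T : Mat2}
    (hT : T ∈ dualLattice σ) (hTp : (p : ℂ)⁻¹ • T ∉ dualLattice σ) :
    ∑ v : Fin 4 → ZMod p, e ((p : ℂ)⁻¹ * (T * hermRep b₁ b₂ v).trace) = 0 := by
  obtain ⟨w, rfl⟩ := (hb.mem_dualLattice_iff T).mp hT
  -- The coefficients of `v` in `trace_mul`: the off-diagonal pairing is alternating, hence the swap
  -- and the sign in the last two entries.
  let c : Fin 4 → ZMod p := ![w 0, w 1, -w 3, w 2]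
  have hterm : ∀ v : Fin 4 → ZMod p,
      e ((p : ℂ)⁻¹ * (dualMatrix K b₁ b₂ w * hermRep b₁ b₂ v).trace) =
        ∏ i, ZMod.stdAddChar (v i * c i) := by
    intro v
    rw [hermRep, hb.trace_mul, e]
    have h := ZMod.stdAddChar_coe (N := p) (w 0 * (v 0).cast + w 1 * (v 1).cast +
      w 2 * (v 3).cast - w 3 * (v 2).cast)
    rw [show 2 * (Real.pi : ℂ) * Complex.I * ((p : ℂ)⁻¹ * ((w 0 * (v 0).cast + w 1 * (v 1).cast +
      w 2 * (v 3).cast - w 3 * (v 2).cast : ℤ) : ℂ)) = 2 * (Real.pi : ℂ) * Complex.I *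
      ((w 0 * (v 0).cast + w 1 * (v 1).cast + w 2 * (v 3).cast - w 3 * (v 2).cast : ℤ) : ℂ) / p
      from by ring, ← h, Fin.prod_univ_four, ← AddChar.map_add_eq_mul, ← AddChar.map_add_eq_mul,
      ← AddChar.map_add_eq_mul]
    congr 1
    push_cast
    simp only [c, Matrix.cons_val]
    ring
  -- The sum factors into four sums over `ZMod p`, the `i`-th of which vanishes unless `c i = 0`. A
  -- nonzero product would thus make all coordinates of `T` divisible by `p`.
  have hprod := Finset.prod_univ_sum (fun _ : Fin 4 => (Finset.univ : Finset (ZMod p)))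
    fun i x => ZMod.stdAddChar (x * c i)
  rw [Fintype.piFinset_univ] at hprod
  rw [Finset.sum_congr rfl fun v _ => hterm v, ← hprod]
  by_contra hne
  apply hTp
  have hc : ∀ i, c i = 0 := by
    intro i
    by_contra hi
    apply hne
    refine Finset.prod_eq_zero (Finset.mem_univ i) ?_
    rw [AddChar.sum_mulShift (c i) (ZMod.isPrimitive_stdAddChar p), if_neg hi, Nat.cast_zero]
  refine inv_smul_dualMatrix_mem hb (Fact.out : p.Prime).ne_zero fun i => ?_
  rw [← ZMod.intCast_zmod_eq_zero_iff_dvd]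
  have h0 := hc 0
  have h1 := hc 1
  have h2 := hc 2
  have h3 := hc 3
  simp only [c, Matrix.cons_val, neg_eq_zero] at h0 h1 h2 h3
  fin_cases i
  · exact h0
  · exact h1
  · exact h3
  · exact h2

/-! ### The Hecke operator on Fourier expansions -/

variable [Algebra.IsQuadraticExtension ℚ K] [NumberField.IsTotallyComplex K] [Fact p.Prime]

theorem moebius_diagP_mul_unipotent_mem {B : Mat2} (hB : B.IsHermitian) {Z : Mat2}
    (hZ : Z ∈ upperHalfSpace) : (p : ℂ)⁻¹ • (Z + B) ∈ upperHalfSpace := by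
  have hp : (0 : ℂ) < (p : ℂ)⁻¹ :=
    RCLike.inv_pos.mpr (Nat.cast_pos.mpr (Fact.out : p.Prime).pos)
  have h : (p : ℂ)⁻¹ • (Z + B) - ((p : ℂ)⁻¹ • (Z + B))ᴴ = (p : ℂ)⁻¹ • (Z - Zᴴ) := by
    rw [conjTranspose_smul, conjTranspose_add, hB.eq, star_inv₀, star_natCast, ← smul_sub,
      add_sub_add_right_eq_sub]
  have h2 := (show PosDef _ from hZ).smul hp
  rw [upperHalfSpace, Set.mem_ofPred_eq, h, smul_comm]
  exact h2

theorem differentiableOn_heckeU (hpN : p ∣ N) {F : Mat2 → ℂ} (hF : F ∈ modularForms σ N k) :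
    DifferentiableOn ℂ (heckeU σ N k p F) upperHalfSpace := by
  obtain ⟨b₁, b₂, hb⟩ := exists_isOrientedBasis σ
  refine DifferentiableOn.congr ?_ fun Z hZ => hb.heckeU_eq_sum hpN hF hZ
  refine DifferentiableOn.const_mul (DifferentiableOn.fun_sum fun v _ => ?_) _
  refine DifferentiableOn.comp (g := F) hF.1 ?_ fun Z hZ =>
    moebius_diagP_mul_unipotent_mem (isHermitian_hermMatrix _ _ _) hZ
  exact DifferentiableOn.const_smul (differentiableOn_id.add_const _) ((p : ℂ)⁻¹)

theorem heckeU_mem_modularForms (hpN : p ∣ N) {F : Mat2 → ℂ} (hF : F ∈ modularForms σ N k) :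
    heckeU σ N k p F ∈ modularForms σ N k := by
  refine ⟨differentiableOn_heckeU hpN hF, fun g hg Z hZ => ?_⟩
  have h := slash_heckeU (p := p) hF hg hZ
  have h0 := (isSimilitude_of_mem_Gamma0 hg).det_den_ne_zero hZ
  rw [slash_eq, inv_mul_eq_iff_eq_mul₀ (pow_ne_zero k h0)] at h
  exact h

/-- The Fourier coefficient of `U_p F` at `T` is `p ^ (4 - 2k)` times that of `F` at `pT`. -/
theorem HasFourierExpansion.heckeU (hpN : p ∣ N) {F C : Mat2 → ℂ} (hF : F ∈ modularForms σ N k)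
    (hC : HasFourierExpansion σ F C) :
    HasFourierExpansion σ (heckeU σ N k p F)
      fun T => (p : ℂ) ^ (-2 * (k : ℤ) + 4) * C ((p : ℂ) • T) := by
  obtain ⟨b₁, b₂, hb⟩ := exists_isOrientedBasis σ
  have hp : (p : ℂ) ≠ 0 := Nat.cast_ne_zero.mpr (Fact.out : p.Prime).ne_zero
  intro Z hZ
  rw [hb.heckeU_eq_sum hpN hF hZ]
  have hsum := (hasSum_sum (s := Finset.univ) fun (v : Fin 4 → ZMod p) _ =>
    hC _ (moebius_diagP_mul_unipotent_mem (p := p)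
      (isHermitian_hermMatrix b₁ b₂ fun i => (v i).cast) hZ)).mul_left ((p : ℂ) ^ (2 * k))⁻¹
  have hterm : ∀ (T : Mat2) (v : Fin 4 → ZMod p),
      e (T * (p : ℂ)⁻¹ • (Z + hermMatrix b₁ b₂ fun i => (v i).cast)).trace =
        e ((p : ℂ)⁻¹ * (T * Z).trace) * e ((p : ℂ)⁻¹ * (T * hermRep b₁ b₂ v).trace) := by
    intro T v
    rw [← e_add, ← mul_add, ← Matrix.trace_add, ← Matrix.mul_add, Matrix.mul_smul,
      Matrix.trace_smul, smul_eq_mul]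
    rfl
  let m : {T : Mat2 // T ∈ dualLattice σ ∧ T.PosSemidef} →
      {T : Mat2 // T ∈ dualLattice σ ∧ T.PosSemidef} := fun T =>
    ⟨(p : ℂ) • T.1, by exact_mod_cast zsmul_mem_dualLattice σ p T.2.1,
      T.2.2.smul (Nat.cast_nonneg p)⟩
  have hm : Function.Injective m := fun S T hST =>
    Subtype.ext (smul_right_injective Mat2 hp (Subtype.ext_iff.mp hST))
  -- Only indices of the form `pT` survive, so the sum is reindexed along `m`; the side goal, that
  -- all other terms vanish, is character orthogonality.
  rw [← hm.hasSum_iff] at hsum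
  · refine (congrArg (HasSum · _) (funext fun T => ?_)).mpr hsum
    have hone (v : Fin 4 → ZMod p) : e (T.1 * hermRep b₁ b₂ v).trace = 1 :=
      hb.e_trace_mul_hermMatrix T.2.1 _
    simp only [Function.comp_apply, m, hterm, hone, mul_one, Finset.sum_const, Finset.card_univ,
      Fintype.card_pi_const, ZMod.card, nsmul_eq_mul, Matrix.smul_mul, Matrix.trace_smul,
      smul_eq_mul, inv_mul_cancel_left₀ hp]
    -- The factor `p⁴` counts the `v`, each contributing a trivial character; `p^(-2k)` comes from
    -- the automorphy factor.
    rw [zpow_add₀ hp, neg_mul, _root_.zpow_neg]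
    push_cast
    norm_cast
    ring
  · rintro ⟨T, hT, hpos⟩ hTm
    have hTp : (p : ℂ)⁻¹ • T ∉ dualLattice σ := fun h => hTm
      ⟨⟨(p : ℂ)⁻¹ • T, h, hpos.smul (by simp)⟩, Subtype.ext (smul_inv_smul₀ hp T)⟩
    simp only [hterm, ← mul_assoc, ← Finset.mul_sum, hb.sum_e_eq_zero hT hTp, mul_zero]

/-! ### Transfer of the Maass relations to `U_p F`. -/

theorem IsMaassFunction.heckeU (hpN : p ∣ N) {F : Mat2 → ℂ} {α : ℕ → ℂ}
    (hF : F ∈ modularForms σ N k) (hα : IsMaassFunction σ N k F α) :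
    IsMaassFunction σ N k (heckeU σ N k p F)
      fun x => (p : ℂ) ^ (-2 * (k : ℤ) + 4) * α (p ^ 2 * x) := by
  obtain ⟨C, hC, h⟩ := hα
  refine ⟨_, hC.heckeU hpN hF, fun T hT hpos hT0 => ?_⟩
  have hp : (p : ℂ) ≠ 0 := Nat.cast_ne_zero.mpr (Fact.out : p.Prime).ne_zero
  have hpT : (p : ℂ) • T ∈ dualLattice σ := by exact_mod_cast zsmul_mem_dualLattice σ p hT
  have hpT0 : (p : ℂ) • T ≠ 0 := smul_ne_zero hp hT0
  rw [h _ hpT (hpos.smul (Nat.cast_nonneg p)) hpT0, Finset.mul_sum]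
  -- The divisors gained in passing from `T` to `pT` are multiples of `p`, and `p ∣ N` excludes
  -- them.
  have hdiv : (content σ ((p : ℂ) • T)).divisors.filter (·.Coprime N) =
      (content σ T).divisors.filter (·.Coprime N) := by
    ext d
    simp only [Finset.mem_filter, dvd_content_iff σ hpT hpT0, dvd_content_iff σ hT hT0]
    refine and_congr_left fun hd => and_congr_right fun hd0 => ?_
    exact inv_smul_smul_mem_dualLattice_iff σ hT hd0 (hd.coprime_dvd_right hpN)
  rw [hdiv]
  refine Finset.sum_congr rfl fun d hd => ?_
  rw [Finset.mem_filter, dvd_content_iff σ hT hT0] at hd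
  rw [detIndex_smul σ p hd.1.2 hpos]
  ring

end HermitianMaass

theorem mainTheorem10 {K : Type*} [Field K] [NumberField K]
    [Algebra.IsQuadraticExtension ℚ K] [NumberField.IsTotallyComplex K] (σ : K →+* ℂ)
    (N k p : ℕ) (hN : 0 < N) (hk : 0 < k)
    (hunits : Nat.card (NumberField.RingOfIntegers K)ˣ ∣ k)
    [Fact p.Prime] (hpN : p ∣ N)
    (F : HermitianMaass.Mat2 → ℂ) (hF : F ∈ HermitianMaass.maassSpace σ N k) :
    HermitianMaass.heckeU σ N k p F ∈ HermitianMaass.maassSpace σ N k ∧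
    ∀ α : ℕ → ℂ, HermitianMaass.IsMaassFunction σ N k F α →
      HermitianMaass.IsMaassFunction σ N k (HermitianMaass.heckeU σ N k p F)
        (fun x => (p : ℂ) ^ (-2 * (k : ℤ) + 4) * α (p ^ 2 * x)) := by
  obtain ⟨hmod, α, hα⟩ := hF
  exact ⟨⟨HermitianMaass.heckeU_mem_modularForms hpN hmod, _, hα.heckeU hpN hmod⟩,
    fun β hβ => hβ.heckeU hpN hmod⟩
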